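/- **$\pi_n(A)$, $n\ge 2$, is a bundle of abelian groups over $M$.** Let $A\to M$ be a Lie algebroid over a smooth manifold $M$: a smooth vector bundle with a bundle map $\sharp:A\to TM$ and a Lie bracket on $\Gamma(A)$ satisfying $[X,fY]=f[X,Y]+(\sharp X)(f)Y$. Let $I=[0,1]$ and let $n\ge 2$. A Lie algebroid morphism $a=\sum_k a_k\,dt_k:TI^n\to A$ over $\gamma:I^n\to M$ is a smooth bundle map whose pull-back of forms commutes with the differentials, $d\,a^*=a^*d_A$. - An *$n$-dimensional $A$-sphere* is such a morphism with $a_k(t)=0$ whenever $t_j\in\{0,1\}$ for some $j\neq k$. - Two $A$-spheres $a^0,a^1$ are *homotopic* if there is a Lie algebroid morphism $h=\sum_{k\le n+1}h_k\,dt_k:TI^{n+1}\to A$ with $a^\epsilon=\sum_{k\le n}h_k(\cdot,\epsilon)\,dt_k$ for $\epsilon=0,1$ and with $h_{n+1}=0$ whenever one of $t_1,\dots,t_n$ is $0$ or $1$. - $\pi_n(A)$ is the set of homotopy classes of $n$-dimensional $A$-spheres. - A *cut-off function* is a smooth $\tau:\mathbb R\to\mathbb R$ with $\tau=0$ on $(-\infty,0]$,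 $\tau=1$ on $[1,\infty)$ and $\tau'>0$ on $(0,1)$. For such a $\tau$ and $1\le i\le n$, the *concatenation* $a^1\odot_{t_i}a^0$ is $a^0\circ dr_0$ for $t_i\in[0,\tfrac12]$ and $a^1\circ dr_1$ for $t_i\in[\tfrac12,1]$, where $r_0$ replaces the coordinate $t_i$ by $\tau(2t_i)$ and $r_1$ replaces it by $\tau(2t_i-1)$. Then: 1. Homotopy is an equivalence relation on the set of $n$-dimensional $A$-spheres. 2. The base map of every $A$-sphere is constant on $\partial I^n$. Its value there, the base point of the sphere, depends only on the homotopy class, and the resulting map $p:\pi_n(A)\to M$ is surjective. 3. For every $x\in M$ the fibre $\pi_n(A,x)=p^{-1}(x)$ is an abelian group under concatenation. That is, for $A$-spheres $a^0,a^1$ based at $x$, every cut-off function $\tau$ and every $i$, the concatenation $a^1\odot_{t_i}a^0$ is again a (smooth) $A$-sphere based at $x$. There is an abelian group structure on $\pi_n(A,x)$ such that $[a^1]\cdot[a^0]=[a^1\odot_{t_i}a^0]$ for all such $a^0,a^1,\tau,i$. Thus $\pi_n(A)$, $n\ge2$, is a bundle of abelian groups over $M$, that is, a family of groups indexed by the points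 of $M$. -/

import Mathlib

open scoped Manifold ContDiff Bundle

noncomputable section

namespace LieAlgebroidHomotopy

/-- A cut-off function: a smooth `τ : ℝ → ℝ` with `τ = 0` on `t ≤ 0`, `τ = 1` on `t ≥ 1`
and `τ' > 0` on `]0,1[`. -/
structure IsCutoff (τ : ℝ → ℝ) : Prop where
  smooth : ContDiff ℝ ∞ τ
  eq_zero : ∀ t, t ≤ 0 → τ t = 0
  eq_one : ∀ t, 1 ≤ t → τ t = 1
  deriv_pos : ∀ t, 0 < t → t < 1 → 0 < deriv τ t

/-- The closed unit cube `I^n`, as a subset of `ℝ^n`. -/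
def cube (n : ℕ) : Set (Fin n → ℝ) := {t | ∀ j, 0 ≤ t j ∧ t j ≤ 1}

/-- The point `(t_1, …, t_n, s)` of `ℝ^{n+1}`. -/
def extend {n : ℕ} (t : Fin n → ℝ) (s : ℝ) : Fin (n + 1) → ℝ :=
  Fin.snoc (α := fun _ => ℝ) t s

section

variable {E : Type*} [NormedAddCommGroup E] [NormedSpace ℝ E]
  {M : Type*} [TopologicalSpace M] [ChartedSpace E M]
  {F : Type*} [NormedAddCommGroup F] [NormedSpace ℝ F]
  {V : M → Type*} [TopologicalSpace (Bundle.TotalSpace F V)]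
  [∀ x, AddCommGroup (V x)] [∀ x, Module ℝ (V x)] [∀ x, TopologicalSpace (V x)]
  [FiberBundle F V] [VectorBundle ℝ F V]

/-- The product `f X` of a smooth function and a smooth section. -/
def smulSection (f : C^∞⟮𝓘(ℝ, E), M; 𝓘(ℝ, ℝ), ℝ⟯) (X : Cₛ^∞⟮𝓘(ℝ, E); F, V⟯) :
    Cₛ^∞⟮𝓘(ℝ, E); F, V⟯ :=
  ⟨fun x => f x • X x, f.contMDiff.smul_section X.contMDiff⟩

variable (E F V) in
/-- A Lie algebroid structure on the vector bundle `V → M`: a smooth bundle map `♯ : V → TM`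
(the anchor) and a Lie bracket on the space of smooth sections of `V`, related by the
Leibniz rule `[X, fY] = f [X, Y] + (♯X)(f) Y`. -/
structure LieAlgebroid [IsManifold 𝓘(ℝ, E) ∞ M] where
  anchor : ∀ x : M, V x →ₗ[ℝ] TangentSpace 𝓘(ℝ, E) x
  anchor_smooth : ContMDiff (𝓘(ℝ, E).prod 𝓘(ℝ, F)) 𝓘(ℝ, E).tangent ∞
    (fun p : Bundle.TotalSpace F V => (⟨p.proj, anchor p.proj p.snd⟩ : TangentBundle 𝓘(ℝ, E) M))
  bracket : Cₛ^∞⟮𝓘(ℝ, E); F, V⟯ →ₗ[ℝ] Cₛ^∞⟮𝓘(ℝ, E); F, V⟯ →ₗ[ℝ] Cₛ^∞⟮𝓘(ℝ, E); F, V⟯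
  bracket_self : ∀ X, bracket X X = 0
  jacobi : ∀ X Y Z, bracket (bracket X Y) Z + bracket (bracket Y Z) X
    + bracket (bracket Z X) Y = 0
  leibniz : ∀ (f : C^∞⟮𝓘(ℝ, E), M; 𝓘(ℝ, ℝ), ℝ⟯) (X Y : Cₛ^∞⟮𝓘(ℝ, E); F, V⟯) (x : M),
    bracket X (smulSection f Y) x = f x • bracket X Y x
      + (id (mfderiv 𝓘(ℝ, E) 𝓘(ℝ, ℝ) f x (anchor x (X x))) : ℝ) • Y x

variable (E F V) in
/-- A smooth section of the dual bundle `V*`, that is, a smooth fibrewise linear function on the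
total space of `V`: an element of `Ω¹(V)`. -/
structure OneForm where
  toFun : ∀ x : M, V x →ₗ[ℝ] ℝ
  smooth : ContMDiff (𝓘(ℝ, E).prod 𝓘(ℝ, F)) 𝓘(ℝ, ℝ) ∞
    (fun p : Bundle.TotalSpace F V => toFun p.proj p.snd)

variable [IsManifold 𝓘(ℝ, E) ∞ M]

/-- `(d_A f)(v) = df (♯ v)`, for a function `f` on `M` and `v` in the fibre over `x`. -/
def LieAlgebroid.dZero (A : LieAlgebroid E F V) (f : M → ℝ) (x : M) (v : V x) : ℝ :=
  mfderiv 𝓘(ℝ, E) 𝓘(ℝ, ℝ) f x (A.anchor x v)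

/-- `(d_A ξ)(X, Y) = (♯X)(ξ(Y)) - (♯Y)(ξ(X)) - ξ([X, Y])` at the point `x`, for a one-form `ξ`
and sections `X`, `Y`. -/
def LieAlgebroid.dOne (A : LieAlgebroid E F V) (ξ : OneForm E F V)
    (X Y : Cₛ^∞⟮𝓘(ℝ, E); F, V⟯) (x : M) : ℝ :=
  A.dZero (fun y => ξ.toFun y (Y y)) x (X x) - A.dZero (fun y => ξ.toFun y (X y)) x (Y x)
    - ξ.toFun x (A.bracket X Y x)

variable (F V) in
/-- The data of a bundle map `a = ∑ a_k dt_k : TI^n → V` over `γ = base : I^n → M`; here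
`comp k t = a_k(t) = a(∂/∂t_k)` lies in the fibre over `γ(t)`. Only the values on the cube `I^n`
matter: every notion below, homotopy included, depends on those values alone. -/
structure CubeMap (n : ℕ) where
  base : (Fin n → ℝ) → M
  comp : Fin n → (Fin n → ℝ) → Bundle.TotalSpace F V
  proj_comp : ∀ k t, (comp k t).proj = base t

/-- The partial derivative `∂g/∂t_i` at the point `t` of the cube (one-sided on the boundary). -/
def partialDeriv {n : ℕ} (i : Fin n) (g : (Fin n → ℝ) → ℝ) (t : Fin n → ℝ) : ℝ :=
  fderivWithin ℝ g (cube n) t (Pi.single i 1)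

/-- `a : TI^n → A` is a morphism of Lie algebroids: a smooth bundle map whose pull-back of forms
commutes with the differentials, `d (a^* ω) = a^* (d_A ω)`, on functions and on one-forms
(which generate the algebra of forms). In the second identity, `a^*(d_A ξ)(∂_i, ∂_j)` at `t` is the
value of `d_A ξ` on sections that extend the vectors `a_i(t)` and `a_j(t)`. -/
structure CubeMap.IsMorphism (A : LieAlgebroid E F V) {n : ℕ} (a : CubeMap F V n) : Prop where
  smooth_base : ContMDiffOn 𝓘(ℝ, Fin n → ℝ) 𝓘(ℝ, E) ∞ a.base (cube n)
  smooth_comp : ∀ k, ContMDiffOn 𝓘(ℝ, Fin n → ℝ) (𝓘(ℝ, E).prod 𝓘(ℝ, F)) ∞ (a.comp k) (cube n)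
  comm_zero : ∀ f : C^∞⟮𝓘(ℝ, E), M; 𝓘(ℝ, ℝ), ℝ⟯, ∀ t ∈ cube n, ∀ i,
    partialDeriv i (fun s => f (a.base s)) t = A.dZero f (a.comp i t).proj (a.comp i t).snd
  comm_one : ∀ ξ : OneForm E F V, ∀ t ∈ cube n, ∀ i j, ∀ X Y : Cₛ^∞⟮𝓘(ℝ, E); F, V⟯,
    (⟨a.base t, X (a.base t)⟩ : Bundle.TotalSpace F V) = a.comp i t →
    (⟨a.base t, Y (a.base t)⟩ : Bundle.TotalSpace F V) = a.comp j t →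
    partialDeriv i (fun s => ξ.toFun (a.comp j s).proj (a.comp j s).snd) t
      - partialDeriv j (fun s => ξ.toFun (a.comp i s).proj (a.comp i s).snd) t
      = A.dOne ξ X Y (a.base t)

/-- `a` is an `n`-dimensional `A`-sphere: a morphism `TI^n → A` such that `a_k(t) = 0` as soon as
one of the `t_j`, `j ≠ k`, is `0` or `1`. -/
structure CubeMap.IsSphere (A : LieAlgebroid E F V) {n : ℕ} (a : CubeMap F V n) : Prop where
  isMorphism : a.IsMorphism A
  boundary : ∀ t ∈ cube n, ∀ k j, j ≠ k → (t j = 0 ∨ t j = 1) → (a.comp k t).snd = 0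

/-- The set `S_n(A)` of `n`-dimensional `A`-spheres. -/
def Sphere (A : LieAlgebroid E F V) (n : ℕ) := {a : CubeMap F V n // a.IsSphere A}

/-- `h` restricts on the face `t_{n+1} = ε` of `I^{n+1}` to `a = ∑_{k ≤ n} h_k(t, ε) dt_k`. -/
def CubeMap.RestrictsTo {n : ℕ} (h : CubeMap F V (n + 1)) (ε : ℝ) (a : CubeMap F V n) : Prop :=
  ∀ t ∈ cube n, h.base (extend t ε) = a.base t ∧
    ∀ k : Fin n, h.comp k.castSucc (extend t ε) = a.comp k t

/-- Homotopy of `A`-spheres: a morphism `h : TI^{n+1} → A` from `a₀` to `a₁` whose last component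
vanishes when one of `t_1, …, t_n` is `0` or `1`. -/
def Homotopic (A : LieAlgebroid E F V) (n : ℕ) (a₀ a₁ : Sphere A n) : Prop :=
  ∃ h : CubeMap F V (n + 1), h.IsMorphism A ∧ h.RestrictsTo 0 a₀.1 ∧ h.RestrictsTo 1 a₁.1 ∧
    ∀ t ∈ cube (n + 1), ∀ j : Fin n, (t j.castSucc = 0 ∨ t j.castSucc = 1) →
      (h.comp (Fin.last n) t).snd = 0

/-- `π_n(A)`: the set of `A`-spheres up to homotopy. -/
def HomotopyGroup (A : LieAlgebroid E F V) (n : ℕ) := Quot (Homotopic A n)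

/-- The homotopy class of an `A`-sphere. -/
def Sphere.cls {A : LieAlgebroid E F V} {n : ℕ} (a : Sphere A n) : HomotopyGroup A n :=
  Quot.mk _ a

/-- The sphere `a` is based at `x`: its base map sends the boundary of the cube to `x`. -/
def Sphere.BasedAt {A : LieAlgebroid E F V} {n : ℕ} (a : Sphere A n) (x : M) : Prop :=
  ∀ t ∈ cube n, (∃ j, t j = 0 ∨ t j = 1) → a.1.base t = x

/-- Scalar multiplication in the fibres of a vector bundle. -/
def fibreSMul (c : ℝ) (p : Bundle.TotalSpace F V) : Bundle.TotalSpace F V :=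
  ⟨p.proj, c • p.snd⟩

/-- The concatenation `a¹ ⊙ a⁰` along `t_i`, with respect to `τ`. With
`r(t) = (t_1, …, τ(2t_i), …, t_n)` when `t_i ≤ 1/2` and `r(t) = (t_1, …, τ(2t_i - 1), …, t_n)`
otherwise, it is `a⁰ ∘ dr` on the first half of the cube and `a¹ ∘ dr` on the second half. -/
def concat {n : ℕ} (τ : ℝ → ℝ) (i : Fin n) (a₁ a₀ : CubeMap F V n) : CubeMap F V n where
  base t := if t i ≤ 1 / 2 then a₀.base (Function.update t i (τ (2 * t i)))
    else a₁.base (Function.update t i (τ (2 * t i - 1)))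
  comp k t := if t i ≤ 1 / 2 then
      fibreSMul (if k = i then 2 * deriv τ (2 * t i) else 1)
        (a₀.comp k (Function.update t i (τ (2 * t i))))
    else
      fibreSMul (if k = i then 2 * deriv τ (2 * t i - 1) else 1)
        (a₁.comp k (Function.update t i (τ (2 * t i - 1))))
  proj_comp k t := by
    split_ifs <;> exact CubeMap.proj_comp _ _ _

end

end LieAlgebroidHomotopy

end

/-! A morphism `a` over `γ` obeys two structure equations, `∂_k (f ∘ γ) = d_A f (a_k)` and `∂_i
ξ(a_j) - ∂_j ξ(a_i) = d_A ξ (a_i, a_j)`. They survive a smooth change of variables `R`, so `a ∘ dR`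
is again a morphism. Every `R` needed here sends each coordinate vector to a multiple of a
coordinate vector, and only that case is treated (`CubeMap.IsMorphism.reparam`). A cut-off function
is flat at both ends, so each half of a concatenation continues smoothly past the middle as one
common map that is constant in `t_i`. This makes the glued map a morphism
(`CubeMap.IsMorphism.glue`).

The equations also propagate boundary conditions. If `a_k` vanishes along a line in direction `k`,
then `γ` is constant on it (`CubeMap.IsMorphism.base_update`); for `n ≥ 2` this moves any boundary
point to the corner `0` and defines the base point. If `a_k` vanishes on a face, then `ξ(a_j)` is
constant in direction `k` there (`CubeMap.IsMorphism.comp_eq_zero`). Hence every slice of a homotopy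
satisfies the boundary condition of a sphere, although the definition imposes it only at the two
ends, and homotopies can themselves be concatenated.

For the group law, reparametrizations of one coordinate with equal end points are joined by linear
interpolation (`homotopic_of_coord`), which yields the unit and the inverses. Concatenations along
two different coordinates satisfy the interchange law exactly (`concat_interchange`). The
Eckmann–Hilton argument then gives associativity, commutativity and independence of `τ` and `i`
together. -/

set_option linter.unusedSectionVars false

open scoped Manifold ContDiff Bundle

noncomputable section

namespace LieAlgebroidHomotopy

section

variable {E : Type*} [NormedAddCommGroup E] [NormedSpace ℝ E]
  {M : Type*} [TopologicalSpace M] [ChartedSpace E M]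
  {F : Type*} [NormedAddCommGroup F] [NormedSpace ℝ F]
  {V : M → Type*} [TopologicalSpace (Bundle.TotalSpace F V)]
  [∀ x, AddCommGroup (V x)] [∀ x, Module ℝ (V x)] [∀ x, TopologicalSpace (V x)]
  [FiberBundle F V] [VectorBundle ℝ F V]
  [IsManifold 𝓘(ℝ, E) ∞ M]

/-! ### Bump functions, extension of vectors to sections, and tensoriality -/

section Bump

variable [FiniteDimensional ℝ E] [T2Space M]

/-- A smooth function that is `1` at a point and supported in a given neighbourhood of it. -/
theorem exists_bump {x : M} {u : Set M} (hu : u ∈ nhds x) :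
    ∃ φ : C^∞⟮𝓘(ℝ, E), M; 𝓘(ℝ, ℝ), ℝ⟯, φ x = 1 ∧ tsupport φ ⊆ u := by
  obtain ⟨φ, -, h⟩ := (SmoothBumpFunction.nhds_basis_tsupport (I := 𝓘(ℝ, E)) x).mem_iff.1 hu
  exact ⟨⟨φ, φ.contMDiff⟩, φ.eq_one, h⟩

/-- Smooth functions separate points. -/
theorem eq_of_forall_smooth_eq {x y : M}
    (h : ∀ f : C^∞⟮𝓘(ℝ, E), M; 𝓘(ℝ, ℝ), ℝ⟯, f x = f y) : x = y := by
  by_contra hxy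
  obtain ⟨φ, h1, h2⟩ := exists_bump (E := E) (isOpen_compl_singleton.mem_nhds hxy : {y}ᶜ ∈ nhds x)
  have : y ∉ tsupport φ := fun hy => h2 hy rfl
  have := image_eq_zero_of_notMem_tsupport this
  rw [← h, h1] at this
  exact one_ne_zero this

variable [ContMDiffVectorBundle ∞ F V 𝓘(ℝ, E)]

/-- Every vector in a fibre extends to a smooth section. -/
theorem exists_section_eq {x : M} (v : V x) : ∃ X : Cₛ^∞⟮𝓘(ℝ, E); F, V⟯, X x = v := by
  let e := trivializationAt F V x
  have hx : x ∈ e.baseSet := FiberBundle.mem_baseSet_trivializationAt F V x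
  obtain ⟨φ, h1, h2⟩ := exists_bump (E := E) (e.open_baseSet.mem_nhds hx)
  have hs : ContMDiffOn 𝓘(ℝ, E) (𝓘(ℝ, E).prod 𝓘(ℝ, F)) ∞
      (fun y => Bundle.TotalSpace.mk' F y (e.symm y (e ⟨x, v⟩).2)) e.baseSet := by
    rw [e.contMDiffOn_section_baseSet_iff]
    refine (contMDiffOn_const (c := (e ⟨x, v⟩).2)).congr fun y hy => ?_
    simp [e.apply_mk_symm hy]
  refine ⟨⟨_, ContMDiffOn.smul_section_of_tsupport φ.contMDiff.contMDiffOn e.open_baseSet h2 hs⟩, ?_⟩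
  change φ x • e.symm x (e ⟨x, v⟩).2 = v
  rw [h1, one_smul, e.symm_apply_apply_mk hx]

/-- One-forms separate the vectors of a fibre. -/
theorem eq_zero_of_forall_oneForm [FiniteDimensional ℝ F] {x : M} (v : V x)
    (h : ∀ ξ : OneForm E F V, ξ.toFun x v = 0) : v = 0 := by
  let e := trivializationAt F V x
  have hx : x ∈ e.baseSet := FiberBundle.mem_baseSet_trivializationAt F V x
  obtain ⟨φ, h1, h2⟩ := exists_bump (E := E) (e.open_baseSet.mem_nhds hx)
  have key : ∀ l : F →L[ℝ] ℝ, l (e ⟨x, v⟩).2 = 0 := by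
    intro l
    let ξ : OneForm E F V :=
      { toFun := fun y => φ y • (l.toLinearMap ∘ₗ e.linearMapAt ℝ y)
        smooth := by
          refine contMDiff_of_tsupport fun p hp => ?_
          have hp' : p.proj ∈ e.baseSet := by
            refine h2 ?_
            have hc : IsClosed {p : Bundle.TotalSpace F V | p.proj ∈ tsupport φ} :=
              (isClosed_tsupport φ).preimage (FiberBundle.continuous_proj F V)
            refine closure_minimal ?_ hc hp
            intro q hq
            refine subset_tsupport _ fun h0 => hq ?_
            simp [h0]
          have hs : p ∈ e.source := e.mem_source.2 hp'
          have he : ContMDiffAt (𝓘(ℝ, E).prod 𝓘(ℝ, F)) 𝓘(ℝ, F) ∞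
              (fun q : Bundle.TotalSpace F V => (e q).2) p :=
            ((Bundle.Trivialization.contMDiffAt_iff (e := e) (f := id) hs).1 contMDiffAt_id).2
          have hφ : ContMDiffAt (𝓘(ℝ, E).prod 𝓘(ℝ, F)) 𝓘(ℝ, ℝ) ∞
              (fun q : Bundle.TotalSpace F V => φ q.proj) p :=
            (φ.contMDiff.comp (Bundle.contMDiff_proj V)) p
          have hl := (l.contMDiff (n := ∞)).contMDiffAt.comp p he
          refine (hφ.smul hl).congr_of_eventuallyEq ?_
          filter_upwards [e.open_source.mem_nhds hs] with q hq
          have hq' := e.mem_source.1 hq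
          simp [hq'] }
    have := h ξ
    simpa [ξ, h1, e.linearMapAt_apply, hx] using this
  have h0 : (e ⟨x, v⟩).2 = 0 := by
    refine (Module.forall_dual_apply_eq_zero_iff ℝ _).1 fun l => ?_
    exact key (LinearMap.toContinuousLinearMap l)
  have := e.symm_apply_apply_mk hx v
  rw [h0] at this
  rw [← this]
  rw [← e.coe_symmₗ (R := ℝ) hx]
  exact map_zero _

/-- A linear functional on sections that is linear over functions, evaluated at `x`, depends only
on the value of the section at `x`. -/
theorem map_eq_zero_of_apply_eq_zero [FiniteDimensional ℝ F] {x : M}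
    (Φ : Cₛ^∞⟮𝓘(ℝ, E); F, V⟯ →ₗ[ℝ] ℝ) (hΦ : ∀ f X, Φ (smulSection f X) = f x * Φ X)
    {X : Cₛ^∞⟮𝓘(ℝ, E); F, V⟯} (hX : X x = 0) : Φ X = 0 := by
  let e := trivializationAt F V x
  have hx : x ∈ e.baseSet := FiberBundle.mem_baseSet_trivializationAt F V x
  obtain ⟨φ, h1, h2⟩ := exists_bump (E := E) (e.open_baseSet.mem_nhds hx)
  have : ContMDiffVectorBundle 1 F V 𝓘(ℝ, E) := .of_le (n := ∞) (by simp)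
  let b := Module.finBasis ℝ F
  let S : Fin (Module.finrank ℝ F) → Cₛ^∞⟮𝓘(ℝ, E); F, V⟯ := fun i =>
    ⟨_, ContMDiffOn.smul_section_of_tsupport φ.contMDiff.contMDiffOn e.open_baseSet h2
      (e.contMDiffOn_localFrame_baseSet ∞ b i)⟩
  have hc : ∀ i, ContMDiff 𝓘(ℝ, E) 𝓘(ℝ, ℝ) ∞
      (fun y => φ y • e.localFrameCoeff 𝓘(ℝ, E) b i y (X y)) := by
    intro i
    refine contMDiff_of_tsupport fun y hy => ?_
    have hy' : y ∈ e.baseSet := h2 (tsupport_smul_subset_left _ _ hy)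
    exact φ.contMDiff.contMDiffAt.smul
      (contMDiffAt_localFrameCoeff (e := e) b hy' X.contMDiff.contMDiffAt i)
  let f : Fin (Module.finrank ℝ F) → C^∞⟮𝓘(ℝ, E), M; 𝓘(ℝ, ℝ), ℝ⟯ := fun i => ⟨_, hc i⟩
  -- The bump enters squared: one factor makes the coefficients global functions, the other makes
  -- the local frame global sections. At `x` every scalar on the right vanishes, `1 - φ * φ` because
  -- `φ x = 1` and the `f i` because `X x = 0`.
  have hX' : X = smulSection (1 - φ * φ) X + ∑ i, smulSection (f i) (S i) := by
    ext y
    have hsum : (∑ i, smulSection (f i) (S i)) y = ∑ i, (smulSection (f i) (S i)) y := by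
      have := congrFun (map_sum (ContMDiffSection.coeAddHom 𝓘(ℝ, E) F ∞ V)
        (fun i => smulSection (f i) (S i)) Finset.univ) y
      rwa [Finset.sum_apply] at this
    change X y = (1 - φ y * φ y) • X y + (∑ i, smulSection (f i) (S i)) y
    rw [hsum]
    by_cases hy : y ∈ e.baseSet
    · have h3 : ∀ i, (smulSection (f i) (S i)) y = (φ y * φ y) •
          (e.localFrameCoeff 𝓘(ℝ, E) b i y (X y) • e.localFrame b i y) := by
        intro i
        change (φ y * e.localFrameCoeff 𝓘(ℝ, E) b i y (X y)) • (φ y • e.localFrame b i y) = _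
        simp only [smul_smul]
        congr 1
        ring
      simp only [h3]
      rw [← Finset.smul_sum, ← e.eq_sum_localFrameCoeff_smul hy, ← add_smul]
      simp
    · have h0 : φ y = 0 := image_eq_zero_of_notMem_tsupport fun h => hy (h2 h)
      have h3 : ∀ i, (smulSection (f i) (S i)) y = 0 := by
        intro i
        change (φ y * e.localFrameCoeff 𝓘(ℝ, E) b i y (X y)) • (φ y • e.localFrame b i y) = 0
        simp [h0]
      simp [h3, h0]
  rw [hX', map_add, map_sum, hΦ]
  have h4 : ∀ i, f i x = 0 := fun i => by
    change φ x • e.localFrameCoeff 𝓘(ℝ, E) b i x (X x) = 0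
    simp [hX]
  have h5 : (1 - φ * φ : C^∞⟮𝓘(ℝ, E), M; 𝓘(ℝ, ℝ), ℝ⟯) x = 0 := by
    change 1 - φ x * φ x = 0
    simp [h1]
  simp [hΦ, h4, h5]

end Bump

/-! ### The differential `d_A` on one-forms is tensorial -/

section Differential

/-- The value of a one-form on a section. -/
def OneForm.eval (ξ : OneForm E F V) (X : Cₛ^∞⟮𝓘(ℝ, E); F, V⟯) : C^∞⟮𝓘(ℝ, E), M; 𝓘(ℝ, ℝ), ℝ⟯ :=
  ⟨fun y => ξ.toFun y (X y), ξ.smooth.comp X.contMDiff⟩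

theorem mdifferentiableAt_smooth (f : C^∞⟮𝓘(ℝ, E), M; 𝓘(ℝ, ℝ), ℝ⟯) (x : M) :
    MDifferentiableAt 𝓘(ℝ, E) 𝓘(ℝ, ℝ) f x :=
  f.contMDiff.contMDiffAt.mdifferentiableAt (by simp)

namespace LieAlgebroid

variable (A : LieAlgebroid E F V)

theorem dZero_add (f g : C^∞⟮𝓘(ℝ, E), M; 𝓘(ℝ, ℝ), ℝ⟯) (x : M) (v : V x) :
    A.dZero (fun y => f y + g y) x v = A.dZero f x v + A.dZero g x v := by
  have := ((mdifferentiableAt_smooth f x).hasMFDerivAt.add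
    (mdifferentiableAt_smooth g x).hasMFDerivAt).mfderiv
  exact congrArg (fun L => L (A.anchor x v)) this

theorem dZero_mul (f g : C^∞⟮𝓘(ℝ, E), M; 𝓘(ℝ, ℝ), ℝ⟯) (x : M) (v : V x) :
    A.dZero (fun y => f y * g y) x v = f x * A.dZero g x v + g x * A.dZero f x v := by
  have := ((mdifferentiableAt_smooth f x).hasMFDerivAt.mul
    (mdifferentiableAt_smooth g x).hasMFDerivAt).mfderiv
  exact congrArg (fun L => L (A.anchor x v)) this

theorem dZero_smul_right (f : M → ℝ) (x : M) (c : ℝ) (v : V x) :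
    A.dZero f x (c • v) = c * A.dZero f x v := by
  unfold dZero
  rw [map_smul, map_smul]
  rfl

theorem dZero_add_right (f : M → ℝ) (x : M) (v w : V x) :
    A.dZero f x (v + w) = A.dZero f x v + A.dZero f x w := by
  unfold dZero
  rw [map_add, map_add]
  rfl

theorem dZero_zero_right (f : M → ℝ) (x : M) : A.dZero f x (0 : V x) = 0 := by
  simpa using A.dZero_smul_right f x 0 0

theorem dOne_swap (ξ : OneForm E F V) (X Y : Cₛ^∞⟮𝓘(ℝ, E); F, V⟯) (x : M) :
    A.dOne ξ X Y x = -A.dOne ξ Y X x := by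
  have h : A.bracket X Y = -A.bracket Y X := by
    have := A.bracket_self (X + Y)
    simp only [map_add, LinearMap.add_apply, A.bracket_self, zero_add, add_zero] at this
    exact (neg_eq_of_add_eq_zero_right this).symm
  unfold dOne
  rw [h, ContMDiffSection.coe_neg, Pi.neg_apply, map_neg]
  ring

/-- The derivative of `f` that the product rule produces in `(♯X)(f ξ(Y))` cancels against the one
in the Leibniz rule for `[X, fY]`. -/
theorem dOne_smulSection (ξ : OneForm E F V) (f : C^∞⟮𝓘(ℝ, E), M; 𝓘(ℝ, ℝ), ℝ⟯)
    (X Y : Cₛ^∞⟮𝓘(ℝ, E); F, V⟯) (x : M) :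
    A.dOne ξ X (smulSection f Y) x = f x * A.dOne ξ X Y x := by
  have h1 : (fun y => ξ.toFun y (smulSection f Y y)) = fun y => f y * ξ.eval Y y := by
    funext y
    exact (ξ.toFun y).map_smul (f y) (Y y)
  have h2 : smulSection f Y x = f x • Y x := rfl
  have h3 := A.leibniz f X Y x
  unfold dOne
  rw [h1, dZero_mul, h2, dZero_smul_right, h3, map_add, map_smul, map_smul]
  change f x * _ + ξ.toFun x (Y x) * A.dZero f x (X x) - f x * _ -
    (f x * _ + A.dZero f x (X x) * ξ.toFun x (Y x)) = f x * (A.dZero (ξ.eval Y) x (X x) - _ - _)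
  ring

theorem dOne_add (ξ : OneForm E F V) (X Y Z : Cₛ^∞⟮𝓘(ℝ, E); F, V⟯) (x : M) :
    A.dOne ξ X (Y + Z) x = A.dOne ξ X Y x + A.dOne ξ X Z x := by
  have h1 : (fun y => ξ.toFun y ((Y + Z) y)) = fun y => ξ.eval Y y + ξ.eval Z y := by
    funext y
    exact (ξ.toFun y).map_add (Y y) (Z y)
  unfold dOne
  rw [h1, dZero_add]
  simp only [map_add, ContMDiffSection.coe_add, Pi.add_apply, dZero_add_right]
  change A.dZero (ξ.eval Y) x _ + _ - _ - _ = A.dZero (ξ.eval Y) x _ - _ - _ + (A.dZero (ξ.eval Z) x _ - _ - _)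
  ring

theorem dOne_smul (ξ : OneForm E F V) (c : ℝ) (X Y : Cₛ^∞⟮𝓘(ℝ, E); F, V⟯) (x : M) :
    A.dOne ξ X (c • Y) x = c * A.dOne ξ X Y x :=
  A.dOne_smulSection ξ (ContMDiffMap.const c) X Y x

/-- `Y ↦ (d_A ξ)(X, Y)(x)` as a linear map. -/
def dOneRight (ξ : OneForm E F V) (X : Cₛ^∞⟮𝓘(ℝ, E); F, V⟯) (x : M) :
    Cₛ^∞⟮𝓘(ℝ, E); F, V⟯ →ₗ[ℝ] ℝ where
  toFun Y := A.dOne ξ X Y x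
  map_add' Y Z := A.dOne_add ξ X Y Z x
  map_smul' c Y := A.dOne_smul ξ c X Y x

variable [FiniteDimensional ℝ E] [T2Space M] [FiniteDimensional ℝ F]
  [ContMDiffVectorBundle ∞ F V 𝓘(ℝ, E)]

theorem dOne_congr_right (ξ : OneForm E F V) (X : Cₛ^∞⟮𝓘(ℝ, E); F, V⟯)
    {Y Y' : Cₛ^∞⟮𝓘(ℝ, E); F, V⟯} {x : M} (h : Y x = Y' x) :
    A.dOne ξ X Y x = A.dOne ξ X Y' x := by
  have h0 : A.dOneRight ξ X x (Y - Y') = 0 :=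
    map_eq_zero_of_apply_eq_zero _ (fun f Z => A.dOne_smulSection ξ f X Z x) (sub_eq_zero.2 h)
  rw [map_sub] at h0
  exact sub_eq_zero.1 h0

/-- `d_A ξ` depends only on the values of the two sections at the point. -/
theorem dOne_congr (ξ : OneForm E F V) {X X' Y Y' : Cₛ^∞⟮𝓘(ℝ, E); F, V⟯} {x : M}
    (hX : X x = X' x) (hY : Y x = Y' x) : A.dOne ξ X Y x = A.dOne ξ X' Y' x := by
  rw [A.dOne_congr_right ξ X hY, A.dOne_swap ξ X, A.dOne_congr_right ξ Y' hX, ← A.dOne_swap]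

theorem dOne_eq_zero_left (ξ : OneForm E F V) {X Y : Cₛ^∞⟮𝓘(ℝ, E); F, V⟯} {x : M}
    (hX : X x = 0) : A.dOne ξ X Y x = 0 := by
  have h0 : A.dOneRight ξ Y x X = 0 :=
    map_eq_zero_of_apply_eq_zero _ (fun f Z => A.dOne_smulSection ξ f Y Z x) hX
  rw [A.dOne_swap]
  exact neg_eq_zero.2 h0

end LieAlgebroid

theorem exists_section_eq_total [FiniteDimensional ℝ E] [T2Space M]
    [ContMDiffVectorBundle ∞ F V 𝓘(ℝ, E)] {x : M} (p : Bundle.TotalSpace F V) (hp : p.proj = x) :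
    ∃ X : Cₛ^∞⟮𝓘(ℝ, E); F, V⟯, (⟨x, X x⟩ : Bundle.TotalSpace F V) = p := by
  subst hp
  obtain ⟨X, hX⟩ := exists_section_eq (E := E) (F := F) p.snd
  exact ⟨X, by rw [hX]⟩

end Differential

/-! ### Calculus on the cube and invariance of morphisms under reparametrization -/

section Cube

theorem cube_eq_Icc (n : ℕ) : cube n = Set.Icc (0 : Fin n → ℝ) 1 := by
  ext t
  simp [cube, Set.mem_Icc, Pi.le_def, forall_and]

theorem uniqueDiffOn_cube (n : ℕ) : UniqueDiffOn ℝ (cube n) := by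
  rw [cube_eq_Icc, ← Set.pi_univ_Icc]
  exact UniqueDiffOn.univ_pi fun i => uniqueDiffOn_Icc one_pos

theorem contMDiffWithinAt_fibreSMul {G : Type*} [NormedAddCommGroup G] [NormedSpace ℝ G]
    {s : Set G} {t : G} {c : G → ℝ} {p : G → Bundle.TotalSpace F V} (hc : ContDiffWithinAt ℝ ∞ c s t)
    (hp : ContMDiffWithinAt 𝓘(ℝ, G) (𝓘(ℝ, E).prod 𝓘(ℝ, F)) ∞ p s t) :
    ContMDiffWithinAt 𝓘(ℝ, G) (𝓘(ℝ, E).prod 𝓘(ℝ, F)) ∞ (fun u => fibreSMul (c u) (p u)) s t := by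
  rw [Bundle.contMDiffWithinAt_totalSpace] at hp ⊢
  refine ⟨hp.1, ?_⟩
  let e := trivializationAt F V (p t).proj
  have ht : (p t).proj ∈ e.baseSet := FiberBundle.mem_baseSet_trivializationAt F V _
  refine (hc.contMDiffWithinAt.smul hp.2).congr_of_eventuallyEq ?_ ?_
  · filter_upwards [hp.1.continuousWithinAt (e.open_baseSet.mem_nhds ht)] with u hu
    exact (e.linear ℝ hu).map_smul (c u) (p u).snd
  · exact (e.linear ℝ ht).map_smul (c t) (p t).snd

theorem OneForm.toFun_fibreSMul (ξ : OneForm E F V) (c : ℝ) (p : Bundle.TotalSpace F V) :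
    ξ.toFun (fibreSMul c p).proj (fibreSMul c p).snd = c * ξ.toFun p.proj p.snd :=
  (ξ.toFun p.proj).map_smul c p.snd

theorem CubeMap.IsMorphism.contDiffOn_oneForm {A : LieAlgebroid E F V} {n : ℕ} {a : CubeMap F V n}
    (ha : a.IsMorphism A) (ξ : OneForm E F V) (k : Fin n) :
    ContDiffOn ℝ ∞ (fun s => ξ.toFun (a.comp k s).proj (a.comp k s).snd) (cube n) :=
  (ξ.smooth.comp_contMDiffOn (ha.smooth_comp k)).contDiffOn

theorem CubeMap.IsMorphism.contDiffOn_function {A : LieAlgebroid E F V} {n : ℕ} {a : CubeMap F V n}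
    (ha : a.IsMorphism A) (f : C^∞⟮𝓘(ℝ, E), M; 𝓘(ℝ, ℝ), ℝ⟯) :
    ContDiffOn ℝ ∞ (fun s => f (a.base s)) (cube n) :=
  (f.contMDiff.comp_contMDiffOn ha.smooth_base).contDiffOn

/-- A smooth map `R` between cubes whose partial derivatives are multiples of coordinate vectors:
`∂_k R = c_k e_{σ k}`. -/
structure IsReparam {m n : ℕ} (R : (Fin m → ℝ) → (Fin n → ℝ)) (σ : Fin m → Fin n)
    (c : Fin m → (Fin m → ℝ) → ℝ) : Prop where
  smooth : ContDiff ℝ ∞ R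
  mapsTo : Set.MapsTo R (cube m) (cube n)
  fderiv_single : ∀ t k, fderiv ℝ R t (Pi.single k 1) = c k t • Pi.single (σ k) 1

/-- The composite `a ∘ dR`, for a map `R` with `∂_k R = c_k e_{σ k}`. -/
def CubeMap.reparam {m n : ℕ} (a : CubeMap F V n) (R : (Fin m → ℝ) → (Fin n → ℝ))
    (σ : Fin m → Fin n) (c : Fin m → (Fin m → ℝ) → ℝ) : CubeMap F V m where
  base t := a.base (R t)
  comp k t := fibreSMul (c k t) (a.comp (σ k) (R t))
  proj_comp k t := a.proj_comp (σ k) (R t)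

namespace IsReparam

variable {m n : ℕ} {R : (Fin m → ℝ) → (Fin n → ℝ)} {σ : Fin m → Fin n}
  {c : Fin m → (Fin m → ℝ) → ℝ}

theorem smooth_coeff (h : IsReparam R σ c) (k : Fin m) : ContDiff ℝ ∞ (c k) := by
  have h1 : ContDiff ℝ ∞ (fun t => fderiv ℝ R t (Pi.single k 1) (σ k)) :=
    contDiff_pi.1 ((h.smooth.fderiv_right (m := ∞) (by simp)).clm_apply contDiff_const) (σ k)
  simpa [h.fderiv_single] using h1

/-- This is the symmetry of the second derivative of `R`, read on two coordinate vectors. The map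
`σ` need not be injective, so it is stated as an identity of vectors. -/
theorem symm (h : IsReparam R σ c) (t : Fin m → ℝ) (i k : Fin m) :
    fderiv ℝ (c k) t (Pi.single i 1) • (Pi.single (σ k) 1 : Fin n → ℝ) =
      fderiv ℝ (c i) t (Pi.single k 1) • Pi.single (σ i) 1 := by
  have hd : DifferentiableAt ℝ (fderiv ℝ R) t :=
    ((h.smooth.fderiv_right (m := ∞) (by simp)).differentiable (by simp)) t
  have key : ∀ i k : Fin m, fderiv ℝ (c k) t (Pi.single i 1) • (Pi.single (σ k) 1 : Fin n → ℝ) =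
      fderiv ℝ (fderiv ℝ R) t (Pi.single i 1) (Pi.single k 1) := by
    intro i k
    have h1 : HasFDerivAt (fun s => fderiv ℝ R s (Pi.single k 1))
        ((fderiv ℝ (fderiv ℝ R) t).flip (Pi.single k 1)) t :=
      hd.hasFDerivAt.clm_apply (hasFDerivAt_const _ _) |>.congr_fderiv (by ext; simp)
    have h2 : HasFDerivAt (fun s => c k s • (Pi.single (σ k) 1 : Fin n → ℝ)) _ t :=
      (((h.smooth_coeff k).differentiable (by simp)) t).hasFDerivAt.smul_const _
    have h3 : (fun s => fderiv ℝ R s (Pi.single k 1)) =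
        fun s => c k s • (Pi.single (σ k) 1 : Fin n → ℝ) := funext fun s => h.fderiv_single s k
    rw [h3] at h1
    have := congrArg (fun L => L (Pi.single i 1)) (h1.unique h2)
    simpa using this.symm
  rw [key, key]
  exact (h.smooth.contDiffAt.isSymmSndFDerivAt
    (by simpa using WithTop.coe_le_coe.2 (le_top : (2 : ℕ∞) ≤ ⊤))) _ _

theorem partialDeriv_comp (h : IsReparam R σ c) {g : (Fin n → ℝ) → ℝ}
    (hg : ContDiffOn ℝ ∞ g (cube n)) {t : Fin m → ℝ} (ht : t ∈ cube m) (k : Fin m) :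
    partialDeriv k (fun s => g (R s)) t = c k t * partialDeriv (σ k) g (R t) := by
  have h1 := (hg.differentiableOn (by simp) _ (h.mapsTo ht)).hasFDerivWithinAt
  have h2 := ((h.smooth.differentiable (by simp)) t).hasFDerivAt.hasFDerivWithinAt (s := cube m)
  have h3 := (h1.comp t h2 h.mapsTo).fderivWithin (uniqueDiffOn_cube m t ht)
  unfold partialDeriv
  change fderivWithin ℝ (g ∘ R) (cube m) t _ = _
  rw [h3]
  simp [h.fderiv_single]

end IsReparam

variable [FiniteDimensional ℝ E] [T2Space M] [FiniteDimensional ℝ F]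
  [ContMDiffVectorBundle ∞ F V 𝓘(ℝ, E)]

/-- Pull-back along `R` commutes with `d`. In components, the chain rule multiplies the structure
equations by the coefficients `c`, and the terms with derivatives of `c` cancel by `IsReparam.symm`.
-/
theorem CubeMap.IsMorphism.reparam {A : LieAlgebroid E F V} {m n : ℕ} {a : CubeMap F V n}
    (ha : a.IsMorphism A) {R : (Fin m → ℝ) → (Fin n → ℝ)} {σ : Fin m → Fin n}
    {c : Fin m → (Fin m → ℝ) → ℝ} (h : IsReparam R σ c) : (a.reparam R σ c).IsMorphism A where
  smooth_base := ha.smooth_base.comp h.smooth.contMDiff.contMDiffOn h.mapsTo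
  smooth_comp k t ht := contMDiffWithinAt_fibreSMul (h.smooth_coeff k).contDiffAt.contDiffWithinAt
    ((ha.smooth_comp (σ k)).comp h.smooth.contMDiff.contMDiffOn h.mapsTo t ht)
  comm_zero f t ht i := by
    refine (h.partialDeriv_comp (ha.contDiffOn_function f) ht i).trans ?_
    rw [ha.comm_zero f _ (h.mapsTo ht)]
    exact (A.dZero_smul_right _ _ _ _).symm
  comm_one ξ t ht i j X Y hX hY := by
    -- `X` and `Y` extend the scaled vectors, while the equation for `a` needs extensions of the
    -- unscaled ones. By tensoriality the scalars may be frozen at `t` and pulled out of `d_A ξ`.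
    obtain ⟨X', hX'⟩ := exists_section_eq_total (E := E) _ (a.proj_comp (σ i) (R t))
    obtain ⟨Y', hY'⟩ := exists_section_eq_total (E := E) _ (a.proj_comp (σ j) (R t))
    have hX0 : X (a.base (R t)) = (c i t • X') (a.base (R t)) := by
      have : (⟨_, X (a.base (R t))⟩ : Bundle.TotalSpace F V) = fibreSMul (c i t) ⟨_, _⟩ :=
        hX.trans (congrArg (fibreSMul (c i t)) hX'.symm)
      exact Bundle.TotalSpace.mk_inj.1 this
    have hY0 : Y (a.base (R t)) = (c j t • Y') (a.base (R t)) := by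
      have : (⟨_, Y (a.base (R t))⟩ : Bundle.TotalSpace F V) = fibreSMul (c j t) ⟨_, _⟩ :=
        hY.trans (congrArg (fibreSMul (c j t)) hY'.symm)
      exact Bundle.TotalSpace.mk_inj.1 this
    have hR : A.dOne ξ X Y (a.base (R t)) = c i t * c j t * A.dOne ξ X' Y' (a.base (R t)) := by
      rw [A.dOne_congr ξ hX0 hY0, A.dOne_smul, A.dOne_swap, A.dOne_smul, A.dOne_swap ξ Y']
      ring
    let G : Fin n → (Fin n → ℝ) → ℝ := fun k s => ξ.toFun (a.comp k s).proj (a.comp k s).snd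
    have hG : ∀ k, ContDiffOn ℝ ∞ (G k) (cube n) := ha.contDiffOn_oneForm ξ
    have hmul : ∀ i j, partialDeriv i (fun s => ξ.toFun ((a.reparam R σ c).comp j s).proj
        ((a.reparam R σ c).comp j s).snd) t = fderiv ℝ (c j) t (Pi.single i 1) * G (σ j) (R t)
          + c j t * (c i t * partialDeriv (σ i) (G (σ j)) (R t)) := by
      intro i j
      have e1 : (fun s => ξ.toFun ((a.reparam R σ c).comp j s).proj
        ((a.reparam R σ c).comp j s).snd) = fun s => c j s * G (σ j) (R s) :=
        funext fun s => ξ.toFun_fibreSMul _ _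
      have hu := uniqueDiffOn_cube m t ht
      have hcd := ((h.smooth_coeff j).differentiable (by simp)) t
      have hgd : DifferentiableWithinAt ℝ (fun s => G (σ j) (R s)) (cube m) t :=
        ((hG (σ j)).comp h.smooth.contDiffOn h.mapsTo).differentiableOn (by simp) t ht
      rw [e1, ← h.partialDeriv_comp (hG (σ j)) ht i]
      unfold partialDeriv
      rw [fderivWithin_fun_mul hu hcd.differentiableWithinAt hgd, hcd.fderivWithin hu]
      simp only [add_apply, smul_apply, smul_eq_mul]
      ring
    -- Pairing the symmetry identity with the covector `l ↦ G l (R t)` turns it into equality of the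
    -- two terms containing derivatives of `c`.
    have hsym := congrArg (fun v : Fin n → ℝ => ∑ l, v l * G l (R t)) (h.symm t i j)
    simp only [Pi.smul_apply, Pi.single_apply, smul_eq_mul, mul_ite, mul_one, mul_zero, ite_mul,
      zero_mul, Finset.sum_ite_eq', Finset.mem_univ, if_true] at hsym
    have ho := ha.comm_one ξ (R t) (h.mapsTo ht) (σ i) (σ j) X' Y' hX' hY'
    rw [hmul, hmul]
    change _ = A.dOne ξ X Y (a.base (R t))
    rw [hR, ← ho, hsym]
    ring

end Cube

/-! ### Gluing morphisms along a hyperplane -/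

section Glue

/-- Two smooth maps into a manifold that agree with a common smooth map beyond, respectively before,
the hypersurface `u = 1/2` glue to a smooth map. -/
theorem contMDiffOn_glue {G : Type*} [NormedAddCommGroup G] [NormedSpace ℝ G]
    {E' : Type*} [NormedAddCommGroup E'] [NormedSpace ℝ E'] {H : Type*} [TopologicalSpace H]
    {J : ModelWithCorners ℝ E' H} {N : Type*} [TopologicalSpace N] [ChartedSpace H N]
    [IsManifold J ∞ N] {s : Set G} {u : G → ℝ} (hu : Continuous u) {f₀ f₁ c g : G → N}
    (h₀ : ContMDiffOn 𝓘(ℝ, G) J ∞ f₀ s) (h₁ : ContMDiffOn 𝓘(ℝ, G) J ∞ f₁ s)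
    (hc : ContMDiffOn 𝓘(ℝ, G) J ∞ c s) (hc₀ : ∀ t ∈ s, 1 / 2 ≤ u t → f₀ t = c t)
    (hc₁ : ∀ t ∈ s, u t ≤ 1 / 2 → f₁ t = c t) (hg₀ : ∀ t ∈ s, u t ≤ 1 / 2 → g t = f₀ t)
    (hg₁ : ∀ t ∈ s, 1 / 2 ≤ u t → g t = f₁ t) : ContMDiffOn 𝓘(ℝ, G) J ∞ g s := by
  intro t ht
  rcases lt_trichotomy (u t) (1 / 2) with h | h | h
  · refine (h₀ t ht).congr_of_eventuallyEq ?_ (hg₀ t ht h.le)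
    filter_upwards [self_mem_nhdsWithin, mem_nhdsWithin_of_mem_nhds
      (hu.continuousAt.preimage_mem_nhds (Iio_mem_nhds h))] with r hr hr'
    exact hg₀ r hr (le_of_lt hr')
  · have e₀ : f₀ t = c t := hc₀ t ht h.ge
    have e₁ : f₁ t = c t := hc₁ t ht h.le
    have eg : g t = c t := (hg₀ t ht h.le).trans e₀
    rw [contMDiffWithinAt_iff_target]
    constructor
    · have k₀ : ContinuousWithinAt g (s ∩ {r | u r ≤ 1 / 2}) t :=
        ((h₀ t ht).continuousWithinAt.mono Set.inter_subset_left).congr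
          (fun r hr => hg₀ r hr.1 hr.2) (hg₀ t ht h.le)
      have k₁ : ContinuousWithinAt g (s ∩ {r | 1 / 2 ≤ u r}) t :=
        ((h₁ t ht).continuousWithinAt.mono Set.inter_subset_left).congr
          (fun r hr => hg₁ r hr.1 hr.2) (hg₁ t ht h.ge)
      refine (k₀.union k₁).mono fun r hr => ?_
      exact (le_total (u r) (1 / 2)).imp (fun h => ⟨hr, h⟩) fun h => ⟨hr, h⟩
    · have m₀ := (contMDiffWithinAt_iff_target.1 (h₀ t ht)).2
      have m₁ := (contMDiffWithinAt_iff_target.1 (h₁ t ht)).2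
      have mc := (contMDiffWithinAt_iff_target.1 (hc t ht)).2
      rw [e₀] at m₀
      rw [e₁] at m₁
      rw [eg]
      -- On either side one of `f₀`, `f₁` equals `c` and the other equals `g`, so in the chart `g`
      -- is the smooth combination `f₀ + f₁ - c`. The identity is algebraic and needs no point to
      -- lie in the chart domain.
      have key : ∀ r ∈ s, extChartAt J (c t) (g r) = extChartAt J (c t) (f₀ r)
          + extChartAt J (c t) (f₁ r) - extChartAt J (c t) (c r) := by
        intro r hr
        rcases le_total (u r) (1 / 2) with h | h
        · rw [hg₀ r hr h, hc₁ r hr h, add_sub_cancel_right]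
        · rw [hg₁ r hr h, hc₀ r hr h, add_sub_cancel_left]
      exact ((m₀.add m₁).sub mc).congr key (key t ht)
  · refine (h₁ t ht).congr_of_eventuallyEq ?_ (hg₁ t ht h.le)
    filter_upwards [self_mem_nhdsWithin, mem_nhdsWithin_of_mem_nhds
      (hu.continuousAt.preimage_mem_nhds (Ioi_mem_nhds h))] with r hr hr'
    exact hg₁ r hr (le_of_lt hr')

theorem uniqueDiffOn_slab {n : ℕ} (i : Fin n) {a b : ℝ} (ha : 0 ≤ a) (hab : a < b) (hb : b ≤ 1) :
    UniqueDiffOn ℝ (cube n ∩ {t | t i ∈ Set.Icc a b}) := by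
  have : cube n ∩ {t | t i ∈ Set.Icc a b} =
      Set.pi Set.univ fun j => if j = i then Set.Icc a b else Set.Icc 0 1 := by
    ext t
    simp only [cube, Set.mem_inter_iff, Set.mem_ofPred_eq, Set.mem_pi, Set.mem_univ, true_imp_iff]
    constructor
    · rintro ⟨h1, h2⟩ j
      split_ifs with h
      · exact h ▸ h2
      · exact h1 j
    · intro h
      have hi := h i
      rw [if_pos rfl] at hi
      refine ⟨fun j => ?_, hi⟩
      by_cases hj : j = i
      · subst hj
        exact ⟨ha.trans hi.1, hi.2.trans hb⟩
      · simpa [hj] using h j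
  rw [this]
  refine UniqueDiffOn.univ_pi fun j => ?_
  split_ifs
  exacts [uniqueDiffOn_Icc hab, uniqueDiffOn_Icc one_pos]

/-- A slab of positive width has unique derivatives at each of its points, so a derivative on the
cube can be computed inside the slab. In particular a derivative on `t_i = 1/2` can be read off from
either half. -/
theorem partialDeriv_congr_slab {n : ℕ} (i : Fin n) {a b : ℝ} (ha : 0 ≤ a) (hab : a < b)
    (hb : b ≤ 1) {f g : (Fin n → ℝ) → ℝ} (hf : ContDiffOn ℝ ∞ f (cube n))
    (hg : ContDiffOn ℝ ∞ g (cube n)) (hfg : ∀ t ∈ cube n, t i ∈ Set.Icc a b → g t = f t)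
    {t : Fin n → ℝ} (ht : t ∈ cube n) (hti : t i ∈ Set.Icc a b) (k : Fin n) :
    partialDeriv k g t = partialDeriv k f t := by
  have hu := uniqueDiffOn_slab i ha hab hb t ⟨ht, hti⟩
  unfold partialDeriv
  rw [← fderivWithin_subset Set.inter_subset_left hu (hg.differentiableOn (by simp) t ht),
    ← fderivWithin_subset Set.inter_subset_left hu (hf.differentiableOn (by simp) t ht),
    fderivWithin_congr (fun s hs => hfg s hs.1 hs.2) (hfg t ht hti)]

/-- Two maps `TI^n → V` agree at the point `t`. -/
def CubeMap.EqAt {n : ℕ} (a b : CubeMap F V n) (t : Fin n → ℝ) : Prop :=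
  a.base t = b.base t ∧ ∀ k, a.comp k t = b.comp k t

/-- Smoothness comes from the common continuation `c`. The structure equations are then pointwise,
and each point lies in a closed half on which `g` coincides with a morphism. -/
theorem CubeMap.IsMorphism.glue [ContMDiffVectorBundle ∞ F V 𝓘(ℝ, E)] {A : LieAlgebroid E F V}
    {n : ℕ} (i : Fin n) {f₀ f₁ c g : CubeMap F V n}
    (h₀ : f₀.IsMorphism A) (h₁ : f₁.IsMorphism A) (hc : c.IsMorphism A)
    (hc₀ : ∀ t ∈ cube n, 1 / 2 ≤ t i → f₀.EqAt c t) (hc₁ : ∀ t ∈ cube n, t i ≤ 1 / 2 → f₁.EqAt c t)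
    (hg₀ : ∀ t ∈ cube n, t i ≤ 1 / 2 → g.EqAt f₀ t)
    (hg₁ : ∀ t ∈ cube n, 1 / 2 ≤ t i → g.EqAt f₁ t) : g.IsMorphism A := by
  have : IsManifold (𝓘(ℝ, E).prod 𝓘(ℝ, F)) ∞ (Bundle.TotalSpace F V) :=
    Bundle.TotalSpace.isManifold F V
  have sb : ContMDiffOn 𝓘(ℝ, Fin n → ℝ) 𝓘(ℝ, E) ∞ g.base (cube n) :=
    contMDiffOn_glue (continuous_apply i) h₀.smooth_base h₁.smooth_base hc.smooth_base
      (fun t ht h => (hc₀ t ht h).1) (fun t ht h => (hc₁ t ht h).1)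
      (fun t ht h => (hg₀ t ht h).1) (fun t ht h => (hg₁ t ht h).1)
  have sc : ∀ k, ContMDiffOn 𝓘(ℝ, Fin n → ℝ) (𝓘(ℝ, E).prod 𝓘(ℝ, F)) ∞ (g.comp k) (cube n) :=
    fun k => contMDiffOn_glue (continuous_apply i) (h₀.smooth_comp k) (h₁.smooth_comp k)
      (hc.smooth_comp k) (fun t ht h => (hc₀ t ht h).2 k) (fun t ht h => (hc₁ t ht h).2 k)
      (fun t ht h => (hg₀ t ht h).2 k) (fun t ht h => (hg₁ t ht h).2 k)
  have slab : ∀ t ∈ cube n, ∃ (f : CubeMap F V n) (a b : ℝ), f.IsMorphism A ∧ 0 ≤ a ∧ a < b ∧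
      b ≤ 1 ∧ t i ∈ Set.Icc a b ∧ ∀ s ∈ cube n, s i ∈ Set.Icc a b → g.EqAt f s := by
    intro t ht
    rcases le_total (t i) (1 / 2) with h | h
    · exact ⟨f₀, 0, 1 / 2, h₀, le_rfl, by norm_num, by norm_num, ⟨(ht i).1, h⟩,
        fun s hs hi => hg₀ s hs hi.2⟩
    · exact ⟨f₁, 1 / 2, 1, h₁, by norm_num, by norm_num, le_rfl, ⟨h, (ht i).2⟩,
        fun s hs hi => hg₁ s hs hi.1⟩
  refine ⟨sb, sc, fun f t ht j => ?_, fun ξ t ht j k X Y hX hY => ?_⟩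
  · obtain ⟨f', a, b, hf', ha, hab, hb, hti, he⟩ := slab t ht
    have hp : partialDeriv j (fun s => f (g.base s)) t = partialDeriv j (fun s => f (f'.base s)) t :=
      partialDeriv_congr_slab i ha hab hb (hf'.contDiffOn_function f)
        (f.contMDiff.comp_contMDiffOn sb).contDiffOn
        (fun s hs hi => congrArg f (he s hs hi).1) ht hti j
    rw [hp, (he t ht hti).2 j]
    exact hf'.comm_zero f t ht j
  · obtain ⟨f', a, b, hf', ha, hab, hb, hti, he⟩ := slab t ht
    have hp : ∀ j k, partialDeriv j (fun s => ξ.toFun (g.comp k s).proj (g.comp k s).snd) t =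
        partialDeriv j (fun s => ξ.toFun (f'.comp k s).proj (f'.comp k s).snd) t := fun j k =>
      partialDeriv_congr_slab i ha hab hb (hf'.contDiffOn_oneForm ξ k)
        (ξ.smooth.comp_contMDiffOn (sc k)).contDiffOn
        (fun s hs hi => congrArg (fun p => ξ.toFun p.proj p.snd) ((he s hs hi).2 k)) ht hti j
    rw [hp, hp]
    have hb := (he t ht hti).1
    rw [(he t ht hti).2, hb] at hX hY
    rw [hb]
    exact hf'.comm_one ξ t ht j k X Y hX hY

end Glue

/-! ### Steps, reparametrization of one coordinate, and concatenation -/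

section Coordinate

/-- A smooth step: a cut-off function, except that it need not be strictly increasing. -/
structure IsStep (τ : ℝ → ℝ) : Prop where
  smooth : ContDiff ℝ ∞ τ
  eq_zero : ∀ t, t ≤ 0 → τ t = 0
  eq_one : ∀ t, 1 ≤ t → τ t = 1
  mem_Icc : ∀ t, τ t ∈ Set.Icc (0 : ℝ) 1

theorem IsCutoff.isStep {τ : ℝ → ℝ} (h : IsCutoff τ) : IsStep τ := by
  refine ⟨h.smooth, h.eq_zero, h.eq_one, fun t => ?_⟩
  have hmono : MonotoneOn τ (Set.Icc 0 1) :=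
    monotoneOn_of_deriv_nonneg (convex_Icc 0 1) h.smooth.continuous.continuousOn
      (h.smooth.differentiable (by simp)).differentiableOn fun x hx => by
        rw [interior_Icc] at hx
        exact (h.deriv_pos x hx.1 hx.2).le
  rcases le_total t 0 with h0 | h0
  · simp [h.eq_zero t h0]
  rcases le_total t 1 with h1 | h1
  · have a := hmono (Set.left_mem_Icc.2 zero_le_one) ⟨h0, h1⟩ h0
    have b := hmono ⟨h0, h1⟩ (Set.right_mem_Icc.2 zero_le_one) h1
    rw [h.eq_zero 0 le_rfl] at a
    rw [h.eq_one 1 le_rfl] at b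
    exact ⟨a, b⟩
  · simp [h.eq_one t h1]

/-- Supplies a definite step for transitivity of homotopy and for the definition of the group law.
-/
theorem isStep_smoothTransition : IsStep Real.smoothTransition :=
  ⟨Real.smoothTransition.contDiff, fun _ => Real.smoothTransition.zero_of_nonpos,
    fun _ => Real.smoothTransition.one_of_one_le,
    fun t => ⟨Real.smoothTransition.nonneg t, Real.smoothTransition.le_one t⟩⟩

/-- At the end point `0` the derivative is still determined by the left half-line, where the step is
constant. -/
theorem IsStep.deriv_eq_zero_of_nonpos {τ : ℝ → ℝ} (h : IsStep τ) {t : ℝ} (ht : t ≤ 0) :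
    deriv τ t = 0 := by
  have h1 := ((h.smooth.differentiable (by simp)) t).hasDerivAt.hasDerivWithinAt (s := Set.Iic t)
  have h2 : HasDerivWithinAt τ 0 (Set.Iic t) t :=
    (hasDerivWithinAt_const t _ (0 : ℝ)).congr (fun s hs => h.eq_zero s (le_trans hs ht))
      (h.eq_zero t ht)
  exact (uniqueDiffWithinAt_Iic t).eq_deriv _ h1 h2

theorem IsStep.deriv_eq_zero_of_one_le {τ : ℝ → ℝ} (h : IsStep τ) {t : ℝ} (ht : 1 ≤ t) :
    deriv τ t = 0 := by
  have h1 := ((h.smooth.differentiable (by simp)) t).hasDerivAt.hasDerivWithinAt (s := Set.Ici t)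
  have h2 : HasDerivWithinAt τ 0 (Set.Ici t) t :=
    (hasDerivWithinAt_const t _ (1 : ℝ)).congr (fun s hs => h.eq_one s (le_trans ht hs))
      (h.eq_one t ht)
  exact (uniqueDiffWithinAt_Ici t).eq_deriv _ h1 h2

theorem update_mem_cube {n : ℕ} {t : Fin n → ℝ} (ht : t ∈ cube n) (i : Fin n) {r : ℝ}
    (hr : r ∈ Set.Icc (0 : ℝ) 1) : Function.update t i r ∈ cube n := by
  intro j
  by_cases h : j = i
  · subst h
    simpa using hr
  · simpa [h] using ht j

/-- A smooth map of the interval to itself. -/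
structure IsIntervalMap (ρ : ℝ → ℝ) : Prop where
  smooth : ContDiff ℝ ∞ ρ
  mapsTo : Set.MapsTo ρ (Set.Icc 0 1) (Set.Icc 0 1)

theorem isIntervalMap_id : IsIntervalMap id := ⟨contDiff_id, Set.mapsTo_id _⟩

theorem isIntervalMap_const {r : ℝ} (hr : r ∈ Set.Icc (0 : ℝ) 1) : IsIntervalMap fun _ => r :=
  ⟨contDiff_const, fun _ _ => hr⟩

theorem isIntervalMap_reverse : IsIntervalMap fun u => 1 - u :=
  ⟨contDiff_const.sub contDiff_id, fun u hu => ⟨by linarith [hu.2], by linarith [hu.1]⟩⟩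

theorem IsStep.isIntervalMap_left {τ : ℝ → ℝ} (h : IsStep τ) : IsIntervalMap fun u => τ (2 * u) :=
  ⟨h.smooth.comp (contDiff_const.mul contDiff_id), fun _ _ => h.mem_Icc _⟩

theorem IsStep.isIntervalMap_right {τ : ℝ → ℝ} (h : IsStep τ) :
    IsIntervalMap fun u => τ (2 * u - 1) :=
  ⟨h.smooth.comp ((contDiff_const.mul contDiff_id).sub contDiff_const), fun _ _ => h.mem_Icc _⟩

theorem IsStep.deriv_left {τ : ℝ → ℝ} (h : IsStep τ) (u : ℝ) :
    deriv (fun u => τ (2 * u)) u = 2 * deriv τ (2 * u) := by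
  have h1 := ((h.smooth.differentiable (by simp)) (2 * u)).hasDerivAt
  have h2 := h1.comp u ((hasDerivAt_id u).const_mul 2)
  rw [mul_comm]
  simpa [Function.comp_def] using h2.deriv

theorem IsStep.deriv_right {τ : ℝ → ℝ} (h : IsStep τ) (u : ℝ) :
    deriv (fun u => τ (2 * u - 1)) u = 2 * deriv τ (2 * u - 1) := by
  have h1 := ((h.smooth.differentiable (by simp)) (2 * u - 1)).hasDerivAt
  have h2 := h1.comp u (((hasDerivAt_id u).const_mul 2).sub_const 1)
  rw [mul_comm]
  simpa [Function.comp_def] using h2.deriv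

/-- The composite of `a` with the map that replaces the coordinate `t_i` by `ρ(t_i)`. -/
def CubeMap.coord {n : ℕ} (a : CubeMap F V n) (ρ : ℝ → ℝ) (i : Fin n) : CubeMap F V n :=
  a.reparam (fun t => Function.update t i (ρ (t i))) id
    (fun k t => if k = i then deriv ρ (t i) else 1)

theorem IsIntervalMap.isReparam {ρ : ℝ → ℝ} (h : IsIntervalMap ρ) {n : ℕ} (i : Fin n) :
    IsReparam (fun t : Fin n → ℝ => Function.update t i (ρ (t i))) id
      (fun k t => if k = i then deriv ρ (t i) else 1) where
  smooth := by
    refine contDiff_pi.2 fun j => ?_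
    by_cases hj : j = i
    · subst hj
      simpa [Function.comp_def] using h.smooth.comp (contDiff_apply ℝ ℝ j)
    · simpa [hj] using contDiff_apply ℝ ℝ j
  mapsTo t ht := update_mem_cube ht i (h.mapsTo (ht i))
  fderiv_single t k := by
    have hd : HasFDerivAt (fun t : Fin n → ℝ => Function.update t i (ρ (t i)))
        (ContinuousLinearMap.pi fun j => if j = i then
          deriv ρ (t i) • ContinuousLinearMap.proj (R := ℝ) (φ := fun _ : Fin n => ℝ) i
          else ContinuousLinearMap.proj j) t := by
      refine hasFDerivAt_pi.2 fun j => ?_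
      by_cases hj : j = i
      · subst hj
        simpa [Function.comp_def] using
          ((h.smooth.differentiable (by simp)) (t j)).hasDerivAt.comp_hasFDerivAt t
            (hasFDerivAt_apply (𝕜 := ℝ) j t)
      · simpa [hj] using hasFDerivAt_apply (𝕜 := ℝ) j t
    rw [hd.fderiv]
    ext j
    by_cases hj : j = i
    · subst hj
      by_cases hk : k = j
      · subst hk
        simp
      · simp [hk, Ne.symm hk]
    · by_cases hk : k = i
      · subst hk
        simp [hj]
      · simp [hj, hk]

theorem fibreSMul_one (p : Bundle.TotalSpace F V) : fibreSMul 1 p = p := by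
  simp [fibreSMul]

theorem fibreSMul_zero_congr {p q : Bundle.TotalSpace F V} (h : p.proj = q.proj) :
    fibreSMul 0 p = fibreSMul 0 q := by
  obtain ⟨x, v⟩ := p
  obtain ⟨y, w⟩ := q
  obtain rfl : x = y := h
  simp [fibreSMul]

theorem snd_fibreSMul_eq_zero (c : ℝ) {p : Bundle.TotalSpace F V} (h : p.snd = 0) :
    (fibreSMul c p).snd = 0 := by
  change c • p.snd = 0
  rw [h, smul_zero]

theorem snd_fibreSMul_zero (p : Bundle.TotalSpace F V) : (fibreSMul 0 p).snd = 0 :=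
  zero_smul ℝ p.snd

theorem total_eq_of_snd_eq_zero {p q : Bundle.TotalSpace F V} (h : p.proj = q.proj)
    (hp : p.snd = 0) (hq : q.snd = 0) : p = q := by
  obtain ⟨x, v⟩ := p
  obtain ⟨y, w⟩ := q
  obtain rfl : x = y := h
  obtain rfl : v = 0 := hp
  obtain rfl : w = 0 := hq
  rfl

/-- On the first half of the cube the concatenation is a composite of `a₀`. -/
theorem concat_eqAt_left {n : ℕ} {τ : ℝ → ℝ} (h : IsStep τ) (i : Fin n) (a₁ a₀ : CubeMap F V n)
    {t : Fin n → ℝ} (ht : t i ≤ 1 / 2) :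
    (concat τ i a₁ a₀).EqAt (a₀.coord (fun u => τ (2 * u)) i) t := by
  refine ⟨if_pos ht, fun k => (if_pos ht).trans ?_⟩
  simp only [CubeMap.coord, CubeMap.reparam, id, h.deriv_left]

/-- The two faces along which maps are concatenated agree. -/
def FacesAgree {n : ℕ} (i : Fin n) (a₁ a₀ : CubeMap F V n) : Prop :=
  ∀ t ∈ cube n, a₁.base (Function.update t i 0) = a₀.base (Function.update t i 1) ∧
    ∀ k, k ≠ i → a₁.comp k (Function.update t i 0) = a₀.comp k (Function.update t i 1)

/-- Past the middle the step has reached `1` with zero derivative, so the first map continues as its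
own end face, constant in `t_i`. -/
theorem coord_left_eqAt {n : ℕ} {τ : ℝ → ℝ} (h : IsStep τ) (i : Fin n) (a : CubeMap F V n)
    {t : Fin n → ℝ} (ht : 1 / 2 ≤ t i) :
    (a.coord (fun u => τ (2 * u)) i).EqAt (a.coord (fun _ => 1) i) t := by
  have h1 : τ (2 * t i) = 1 := h.eq_one _ (by linarith)
  have h2 : deriv τ (2 * t i) = 0 := h.deriv_eq_zero_of_one_le (by linarith)
  refine ⟨?_, fun k => ?_⟩
  · simp only [CubeMap.coord, CubeMap.reparam, h1]
  · simp only [CubeMap.coord, CubeMap.reparam, h1, h.deriv_left, h2, deriv_const, mul_zero]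

theorem coord_right_eqAt {n : ℕ} {τ : ℝ → ℝ} (h : IsStep τ) (i : Fin n) {a₁ a₀ : CubeMap F V n}
    (hf : FacesAgree i a₁ a₀) {t : Fin n → ℝ} (ht : t ∈ cube n) (hi : t i ≤ 1 / 2) :
    (a₁.coord (fun u => τ (2 * u - 1)) i).EqAt (a₀.coord (fun _ => 1) i) t := by
  have h1 : τ (2 * t i - 1) = 0 := h.eq_zero _ (by linarith)
  have h2 : deriv τ (2 * t i - 1) = 0 := h.deriv_eq_zero_of_nonpos (by linarith)
  refine ⟨?_, fun k => ?_⟩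
  · simp only [CubeMap.coord, CubeMap.reparam, h1, (hf t ht).1]
  · simp only [CubeMap.coord, CubeMap.reparam, h1, h.deriv_right, h2, deriv_const, mul_zero, id]
    split_ifs with hk
    -- The `i`-th component is multiplied by `0`; this is why `FacesAgree` says nothing about that
    -- component.
    · exact fibreSMul_zero_congr (by rw [a₁.proj_comp, a₀.proj_comp, (hf t ht).1])
    · rw [(hf t ht).2 k hk]

/-- On the second half of the cube the concatenation is a composite of `a₁`. -/
theorem concat_eqAt_right {n : ℕ} {τ : ℝ → ℝ} (h : IsStep τ) (i : Fin n) {a₁ a₀ : CubeMap F V n}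
    (hf : FacesAgree i a₁ a₀) {t : Fin n → ℝ} (ht : t ∈ cube n) (hi : 1 / 2 ≤ t i) :
    (concat τ i a₁ a₀).EqAt (a₁.coord (fun u => τ (2 * u - 1)) i) t := by
  rcases hi.eq_or_lt with hi' | hi'
  · have e1 := concat_eqAt_left h i a₁ a₀ hi'.ge
    have e2 := coord_left_eqAt h i a₀ hi
    have e3 := coord_right_eqAt h i hf ht hi'.ge
    exact ⟨e1.1.trans (e2.1.trans e3.1.symm),
      fun k => (e1.2 k).trans ((e2.2 k).trans (e3.2 k).symm)⟩
  · refine ⟨if_neg hi'.not_ge, fun k => (if_neg hi'.not_ge).trans ?_⟩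
    simp only [CubeMap.coord, CubeMap.reparam, id, h.deriv_right]

variable [FiniteDimensional ℝ E] [T2Space M] [FiniteDimensional ℝ F]
  [ContMDiffVectorBundle ∞ F V 𝓘(ℝ, E)]

theorem CubeMap.IsMorphism.coord {A : LieAlgebroid E F V} {n : ℕ} {a : CubeMap F V n}
    (ha : a.IsMorphism A) {ρ : ℝ → ℝ} (h : IsIntervalMap ρ) (i : Fin n) :
    (a.coord ρ i).IsMorphism A :=
  ha.reparam (h.isReparam i)

/-- The concatenation of morphisms that agree on the common face is a morphism. -/
theorem CubeMap.IsMorphism.concat {A : LieAlgebroid E F V} {n : ℕ} {a₁ a₀ : CubeMap F V n}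
    (h₁ : a₁.IsMorphism A) (h₀ : a₀.IsMorphism A) {τ : ℝ → ℝ} (h : IsStep τ) {i : Fin n}
    (hf : FacesAgree i a₁ a₀) : (concat τ i a₁ a₀).IsMorphism A :=
  .glue i (h₀.coord h.isIntervalMap_left i) (h₁.coord h.isIntervalMap_right i)
    (h₀.coord (isIntervalMap_const (Set.right_mem_Icc.2 zero_le_one)) i)
    (fun _ _ hi => coord_left_eqAt h i a₀ hi) (fun _ ht hi => coord_right_eqAt h i hf ht hi)
    (fun _ _ hi => concat_eqAt_left h i a₁ a₀ hi) (fun _ ht hi => concat_eqAt_right h i hf ht hi)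

end Coordinate

/-! ### Propagation along the cube, and homotopy as an equivalence relation -/

section Homotopy

theorem extend_mem_cube {n : ℕ} {t : Fin n → ℝ} (ht : t ∈ cube n) {s : ℝ}
    (hs : s ∈ Set.Icc (0 : ℝ) 1) : extend t s ∈ cube (n + 1) := by
  intro j
  refine Fin.lastCases ?_ (fun k => ?_) j
  · simpa [extend] using hs
  · simpa [extend] using ht k

theorem init_mem_cube {n : ℕ} {t : Fin (n + 1) → ℝ} (ht : t ∈ cube (n + 1)) :
    (Fin.init t : Fin n → ℝ) ∈ cube n :=
  fun j => ht j.castSucc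

theorem update_last_eq_extend {n : ℕ} (t : Fin (n + 1) → ℝ) (s : ℝ) :
    Function.update t (Fin.last n) s = extend (Fin.init t : Fin n → ℝ) s := by
  conv_lhs => rw [← Fin.snoc_init_self t]
  exact Fin.update_snoc_last ..

theorem update_extend_last {n : ℕ} (t : Fin n → ℝ) (r s : ℝ) :
    Function.update (extend t r) (Fin.last n) s = extend t s :=
  Fin.update_snoc_last ..

theorem update_extend_castSucc {n : ℕ} (t : Fin n → ℝ) (s : ℝ) (i : Fin n) (r : ℝ) :
    Function.update (extend t s) i.castSucc r = extend (Function.update t i r) s :=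
  (Fin.snoc_update ..).symm

@[simp] theorem extend_castSucc {n : ℕ} (t : Fin n → ℝ) (s : ℝ) (i : Fin n) :
    extend t s i.castSucc = t i :=
  Fin.snoc_castSucc ..

@[simp] theorem extend_last {n : ℕ} (t : Fin n → ℝ) (s : ℝ) : extend t s (Fin.last n) = s :=
  Fin.snoc_last ..

theorem hasDerivWithinAt_update {n : ℕ} {g : (Fin n → ℝ) → ℝ} (hg : ContDiffOn ℝ ∞ g (cube n))
    {t : Fin n → ℝ} (ht : t ∈ cube n) (k : Fin n) {r : ℝ} (hr : r ∈ Set.Icc (0 : ℝ) 1) :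
    HasDerivWithinAt (fun s => g (Function.update t k s))
      (partialDeriv k g (Function.update t k r)) (Set.Icc 0 1) r :=
  (hg.differentiableOn (by simp) _ (update_mem_cube ht k hr)).hasFDerivWithinAt.comp_hasDerivWithinAt
    r (hasDerivAt_update t k r).hasDerivWithinAt fun _ hs => update_mem_cube ht k hs

theorem eq_of_partialDeriv_eq_zero {n : ℕ} {g : (Fin n → ℝ) → ℝ} (hg : ContDiffOn ℝ ∞ g (cube n))
    {t : Fin n → ℝ} (ht : t ∈ cube n) (k : Fin n)
    (h : ∀ r ∈ Set.Icc (0 : ℝ) 1, partialDeriv k g (Function.update t k r) = 0) {r : ℝ}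
    (hr : r ∈ Set.Icc (0 : ℝ) 1) : g (Function.update t k r) = g (Function.update t k 0) := by
  refine constant_of_derivWithin_zero (f := fun s => g (Function.update t k s))
    (fun s hs => (hasDerivWithinAt_update hg ht k hs).differentiableWithinAt) (fun s hs => ?_) r hr
  have hs' : s ∈ Set.Icc (0 : ℝ) 1 := Set.Ico_subset_Icc_self hs
  rw [(hasDerivWithinAt_update hg ht k hs').derivWithin (uniqueDiffOn_Icc one_pos s hs'), h s hs']

theorem partialDeriv_eq_zero {n : ℕ} {g : (Fin n → ℝ) → ℝ} (hg : ContDiffOn ℝ ∞ g (cube n))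
    {t : Fin n → ℝ} (ht : t ∈ cube n) (k : Fin n)
    (h : ∀ r ∈ Set.Icc (0 : ℝ) 1, g (Function.update t k r) = 0) : partialDeriv k g t = 0 := by
  have h1 := hasDerivWithinAt_update hg ht k (ht k)
  rw [Function.update_eq_self] at h1
  have h2 : HasDerivWithinAt (fun s => g (Function.update t k s)) 0 (Set.Icc 0 1) (t k) :=
    (hasDerivWithinAt_const _ _ (0 : ℝ)).congr h (h _ (ht k))
  exact (uniqueDiffOn_Icc one_pos _ (ht k)).eq_deriv _ h1 h2

/-- A component of a concatenation vanishes on a pair of opposite faces if the two maps do so. -/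
theorem concat_boundary {n : ℕ} {τ : ℝ → ℝ} (h : IsStep τ) (i : Fin n) {a₁ a₀ : CubeMap F V n}
    {k j : Fin n} (h₁ : ∀ t ∈ cube n, (t j = 0 ∨ t j = 1) → (a₁.comp k t).snd = 0)
    (h₀ : ∀ t ∈ cube n, (t j = 0 ∨ t j = 1) → (a₀.comp k t).snd = 0) {t : Fin n → ℝ}
    (ht : t ∈ cube n) (htj : t j = 0 ∨ t j = 1) : ((concat τ i a₁ a₀).comp k t).snd = 0 := by
  by_cases hi : t i ≤ 1 / 2
  · have e : (concat τ i a₁ a₀).comp k t = fibreSMul _ _ := if_pos hi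
    rw [e]
    refine snd_fibreSMul_eq_zero _ (h₀ _ (update_mem_cube ht i (h.mem_Icc _)) ?_)
    by_cases hj : j = i
    · subst hj
      have : t j = 0 := htj.resolve_right fun h => by rw [h] at hi; norm_num at hi
      left
      simp [this, h.eq_zero]
    · simpa [hj] using htj
  · have e : (concat τ i a₁ a₀).comp k t = fibreSMul _ _ := if_neg hi
    rw [e]
    refine snd_fibreSMul_eq_zero _ (h₁ _ (update_mem_cube ht i (h.mem_Icc _)) ?_)
    by_cases hj : j = i
    · subst hj
      have : t j = 1 := htj.resolve_left fun h => by rw [h] at hi; norm_num at hi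
      right
      rw [this]
      norm_num [h.eq_one]
    · simpa [hj] using htj

theorem coord_reverse_boundary {n : ℕ} (i : Fin n) {a : CubeMap F V n} {k j : Fin n}
    (h : ∀ t ∈ cube n, (t j = 0 ∨ t j = 1) → (a.comp k t).snd = 0) {t : Fin n → ℝ}
    (ht : t ∈ cube n) (htj : t j = 0 ∨ t j = 1) :
    ((a.coord (fun u => 1 - u) i).comp k t).snd = 0 := by
  refine snd_fibreSMul_eq_zero _ (h _ (isIntervalMap_reverse.isReparam i |>.mapsTo ht) ?_)
  by_cases hj : j = i
  · subst hj
    rcases htj with h | h <;> simp [h]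
  · simpa [hj] using htj

variable [FiniteDimensional ℝ E] [T2Space M]

/-- By the structure equation for functions, every smooth `f ∘ γ` has zero derivative along the
line, and smooth functions separate the points of `M`. -/
theorem CubeMap.IsMorphism.base_update {A : LieAlgebroid E F V} {n : ℕ} {a : CubeMap F V n}
    (ha : a.IsMorphism A) {t : Fin n → ℝ} (ht : t ∈ cube n) (k : Fin n)
    (h : ∀ r ∈ Set.Icc (0 : ℝ) 1, (a.comp k (Function.update t k r)).snd = 0) {r : ℝ}
    (hr : r ∈ Set.Icc (0 : ℝ) 1) : a.base (Function.update t k r) = a.base t := by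
  have key : ∀ r ∈ Set.Icc (0 : ℝ) 1,
      a.base (Function.update t k r) = a.base (Function.update t k 0) := by
    intro r hr
    refine eq_of_forall_smooth_eq (E := E) fun f => ?_
    refine eq_of_partialDeriv_eq_zero (ha.contDiffOn_function f) ht k (fun s hs => ?_) hr
    rw [ha.comm_zero f _ (update_mem_cube ht k hs), h s hs, A.dZero_zero_right]
  have h2 := key _ (ht k)
  rw [Function.update_eq_self] at h2
  exact (key r hr).trans h2.symm

variable [FiniteDimensional ℝ F] [ContMDiffVectorBundle ∞ F V 𝓘(ℝ, E)]

/-- If the `k`-th component of a morphism vanishes on a face parallel to the `j`-th and `k`-th axes,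
then the vanishing of the `j`-th component propagates along the `k`-th axis in that face. -/
theorem CubeMap.IsMorphism.comp_eq_zero {A : LieAlgebroid E F V} {n : ℕ} {a : CubeMap F V n}
    (ha : a.IsMorphism A) {i j k : Fin n} (hj : j ≠ i) (hk : k ≠ i) {ε : ℝ}
    (h : ∀ t ∈ cube n, t i = ε → (a.comp k t).snd = 0) {t : Fin n → ℝ} (ht : t ∈ cube n)
    (hti : t i = ε) (h0 : (a.comp j (Function.update t k 0)).snd = 0) : (a.comp j t).snd = 0 := by
  refine eq_zero_of_forall_oneForm (E := E) (F := F) _ fun ξ => ?_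
  -- In the structure equation for the pair `(k, j)` the right side vanishes because `a_k = 0`. So
  -- does `∂_j ξ(a_k)`, since a line in direction `j` stays in the face. What remains is `∂_k ξ(a_j)
  -- = 0`.
  have key := eq_of_partialDeriv_eq_zero (ha.contDiffOn_oneForm ξ j) ht k (fun s hs => ?_) (ht k)
  · rw [Function.update_eq_self, h0, map_zero] at key
    exact key
  · have hw := update_mem_cube ht k hs
    have hwi : Function.update t k s i = ε := by rwa [Function.update_of_ne (Ne.symm hk)]
    generalize Function.update t k s = w at hw hwi
    obtain ⟨X, hX⟩ := exists_section_eq_total (E := E) _ (a.proj_comp k w)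
    obtain ⟨Y, hY⟩ := exists_section_eq_total (E := E) _ (a.proj_comp j w)
    have h1 := ha.comm_one ξ w hw k j X Y hX hY
    have hX0 : X (a.base w) = 0 := by
      have := total_eq_of_snd_eq_zero (q := (⟨a.base w, 0⟩ : Bundle.TotalSpace F V))
        (a.proj_comp k w) (h w hw hwi) rfl
      exact Bundle.TotalSpace.mk_inj.1 (hX.trans this)
    rw [A.dOne_eq_zero_left ξ hX0, partialDeriv_eq_zero (ha.contDiffOn_oneForm ξ k) hw j
      fun r hr => ?_, sub_zero] at h1
    · exact h1
    · rw [h _ (update_mem_cube hw j hr) (by rwa [Function.update_of_ne (Ne.symm hj)]), map_zero]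

/-- `h` is a homotopy of spheres from `a₀` to `a₁`. -/
structure IsHomotopy (A : LieAlgebroid E F V) {n : ℕ} (h : CubeMap F V (n + 1))
    (a₀ a₁ : CubeMap F V n) : Prop where
  isMorphism : h.IsMorphism A
  left : h.RestrictsTo 0 a₀
  right : h.RestrictsTo 1 a₁
  boundary : ∀ t ∈ cube (n + 1), ∀ j : Fin n, (t j.castSucc = 0 ∨ t j.castSucc = 1) →
    (h.comp (Fin.last n) t).snd = 0

theorem homotopic_iff {A : LieAlgebroid E F V} {n : ℕ} {a₀ a₁ : Sphere A n} :
    Homotopic A n a₀ a₁ ↔ ∃ h, IsHomotopy A h a₀.1 a₁.1 :=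
  ⟨fun ⟨h, h1, h2, h3, h4⟩ => ⟨h, h1, h2, h3, h4⟩, fun ⟨h, H⟩ => ⟨h, H.1, H.2, H.3, H.4⟩⟩

namespace IsHomotopy

variable {A : LieAlgebroid E F V} {n : ℕ} {h : CubeMap F V (n + 1)} {a₀ a₁ : CubeMap F V n}

/-- A homotopy does not move the base points of the boundary. -/
theorem base_eq (H : IsHomotopy A h a₀ a₁) {t : Fin n → ℝ} (ht : t ∈ cube n) {j : Fin n}
    (hj : t j = 0 ∨ t j = 1) {s : ℝ} (hs : s ∈ Set.Icc (0 : ℝ) 1) :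
    h.base (extend t s) = a₀.base t := by
  rw [← (H.left t ht).1, ← update_extend_last t 0 s]
  refine H.isMorphism.base_update
    (extend_mem_cube ht (Set.left_mem_Icc.2 zero_le_one)) _ (fun r hr => ?_) hs
  rw [update_extend_last]
  exact H.boundary _ (extend_mem_cube ht hr) j (by simpa using hj)

/-- The slices of a homotopy satisfy the boundary condition of spheres. -/
theorem comp_eq_zero (H : IsHomotopy A h a₀ a₁) (ha : a₀.IsSphere A) {t : Fin n → ℝ}
    (ht : t ∈ cube n) {j k : Fin n} (hjk : j ≠ k) (hj : t j = 0 ∨ t j = 1) {s : ℝ}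
    (hs : s ∈ Set.Icc (0 : ℝ) 1) : (h.comp k.castSucc (extend t s)).snd = 0 := by
  refine H.isMorphism.comp_eq_zero (i := j.castSucc) (j := k.castSucc) (k := Fin.last n) (ε := t j)
    (fun h => hjk (Fin.castSucc_injective n h).symm) (Fin.castSucc_lt_last j).ne'
    (fun u hu huj => H.boundary u hu j (huj ▸ hj)) (extend_mem_cube ht hs) (by simp) ?_
  rw [update_extend_last, (H.left t ht).2 k]
  exact ha.boundary t ht k j hjk hj

theorem symm (H : IsHomotopy A h a₀ a₁) :
    IsHomotopy A (h.coord (fun u => 1 - u) (Fin.last n)) a₁ a₀ where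
  isMorphism := H.isMorphism.coord isIntervalMap_reverse _
  left t ht := by
    simpa [CubeMap.coord, CubeMap.reparam, update_extend_last, fibreSMul_one,
      (Fin.castSucc_lt_last _).ne] using H.right t ht
  right t ht := by
    simpa [CubeMap.coord, CubeMap.reparam, update_extend_last, fibreSMul_one,
      (Fin.castSucc_lt_last _).ne] using H.left t ht
  boundary t ht j hj := coord_reverse_boundary _ (fun u hu hj => H.boundary u hu j hj) ht hj

/-- The homotopies are concatenated in the homotopy parameter; their common face is `a₁`. -/
theorem trans {h' : CubeMap F V (n + 1)} {a₂ : CubeMap F V n} (H : IsHomotopy A h a₀ a₁)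
    (H' : IsHomotopy A h' a₁ a₂) {τ : ℝ → ℝ} (hτ : IsStep τ) :
    IsHomotopy A (concat τ (Fin.last n) h' h) a₀ a₂ := by
  have hf : FacesAgree (Fin.last n) h' h := by
    intro t ht
    rw [update_last_eq_extend, update_last_eq_extend]
    have h1 := H.right _ (init_mem_cube ht)
    have h2 := H'.left _ (init_mem_cube ht)
    refine ⟨h2.1.trans h1.1.symm, fun k hk => ?_⟩
    obtain ⟨k, rfl⟩ := Fin.exists_castSucc_eq.2 hk
    exact (h2.2 k).trans (h1.2 k).symm
  refine ⟨H'.isMorphism.concat H.isMorphism hτ hf, fun t ht => ?_, fun t ht => ?_, fun t ht j hj =>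
    concat_boundary hτ _ (fun u hu hj => H'.boundary u hu j hj)
      (fun u hu hj => H.boundary u hu j hj) ht hj⟩
  · have e := concat_eqAt_left hτ (Fin.last n) h' h (t := extend t 0) (by simp)
    rw [e.1]
    simp only [e.2]
    simpa [CubeMap.coord, CubeMap.reparam, update_extend_last, fibreSMul_one, hτ.eq_zero,
      (Fin.castSucc_lt_last _).ne] using H.left t ht
  · have e := concat_eqAt_right hτ (Fin.last n) hf (t := extend t 1)
      (extend_mem_cube ht (Set.right_mem_Icc.2 zero_le_one)) (by norm_num)
    have e1 : τ (2 - 1) = 1 := hτ.eq_one _ (by norm_num)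
    rw [e.1]
    simp only [e.2]
    simpa [CubeMap.coord, CubeMap.reparam, update_extend_last, fibreSMul_one, e1,
      (Fin.castSucc_lt_last _).ne] using H'.right t ht

end IsHomotopy

/-- The homotopy `(t, s) ↦ (t_1, …, (1 - s) ρ₀(t_i) + s ρ₁(t_i), …, t_n)`. -/
def interpolate {n : ℕ} (ρ₀ ρ₁ : ℝ → ℝ) (i : Fin n) (t : Fin (n + 1) → ℝ) : Fin n → ℝ :=
  Function.update (Fin.init t : Fin n → ℝ) i ((1 - t (Fin.last n)) * ρ₀ (t i.castSucc)
    + t (Fin.last n) * ρ₁ (t i.castSucc))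

/-- The coefficients of the partial derivatives of `interpolate`. -/
def interpolateCoeff {n : ℕ} (ρ₀ ρ₁ : ℝ → ℝ) (i : Fin n) (k : Fin (n + 1)) (t : Fin (n + 1) → ℝ) :
    ℝ :=
  Fin.lastCases (motive := fun _ => ℝ) (ρ₁ (t i.castSucc) - ρ₀ (t i.castSucc))
    (fun k => if k = i then (1 - t (Fin.last n)) * deriv ρ₀ (t i.castSucc)
      + t (Fin.last n) * deriv ρ₁ (t i.castSucc) else 1) k

/-- Both `∂_i` and the homotopy direction are sent to multiples of `e_i`, the latter with
coefficient `ρ₁ - ρ₀`. -/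
theorem isReparam_interpolate {n : ℕ} {ρ₀ ρ₁ : ℝ → ℝ} (h₀ : IsIntervalMap ρ₀)
    (h₁ : IsIntervalMap ρ₁) (i : Fin n) :
    IsReparam (interpolate ρ₀ ρ₁ i) (fun k => Fin.lastCases (motive := fun _ => Fin n) i id k)
      (interpolateCoeff ρ₀ ρ₁ i) where
  smooth := by
    have hl : ContDiff ℝ ∞ fun t : Fin (n + 1) → ℝ => t (Fin.last n) := contDiff_apply ..
    have hi : ContDiff ℝ ∞ fun t : Fin (n + 1) → ℝ => t i.castSucc := contDiff_apply ..
    refine contDiff_pi.2 fun j => ?_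
    by_cases hj : j = i
    · subst hj
      simpa [interpolate, Function.comp_def] using
        ((contDiff_const.sub hl).mul (h₀.smooth.comp hi)).add (hl.mul (h₁.smooth.comp hi))
    · simpa [interpolate, hj, Fin.init] using contDiff_apply ℝ ℝ j.castSucc
  mapsTo t ht := by
    refine update_mem_cube (init_mem_cube ht) i ?_
    have hs := ht (Fin.last n)
    exact convex_Icc (0 : ℝ) 1 (h₀.mapsTo (ht i.castSucc)) (h₁.mapsTo (ht i.castSucc))
      (sub_nonneg.2 hs.2) hs.1 (by ring)
  fderiv_single t k := by
    let P : Fin (n + 1) → ((Fin (n + 1) → ℝ) →L[ℝ] ℝ) := fun l => ContinuousLinearMap.proj l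
    have hP : ∀ l, HasFDerivAt (fun t : Fin (n + 1) → ℝ => t l) (P l) t :=
      fun l => hasFDerivAt_apply (𝕜 := ℝ) l t
    have d₀ := ((h₀.smooth.differentiable (by simp)) (t i.castSucc)).hasDerivAt.comp_hasFDerivAt t
      (hP i.castSucc)
    have d₁ := ((h₁.smooth.differentiable (by simp)) (t i.castSucc)).hasDerivAt.comp_hasFDerivAt t
      (hP i.castSucc)
    have d := (((hP (Fin.last n)).const_sub 1).mul d₀).add ((hP (Fin.last n)).mul d₁)
    have hd := hasFDerivAt_pi (φ := fun (j : Fin n) (t : Fin (n + 1) → ℝ) => interpolate ρ₀ ρ₁ i t j)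
      (φ' := fun j => if j = i then _ else P j.castSucc) (x := t) |>.2 fun j => by
        by_cases hj : j = i
        · subst hj
          rw [if_pos rfl]
          exact d.congr_of_eventuallyEq (.of_forall fun t => by simp [interpolate])
        · rw [if_neg hj]
          exact (hP j.castSucc).congr_of_eventuallyEq
            (.of_forall fun t => by simp [interpolate, hj, Fin.init])
    have hd' : HasFDerivAt (interpolate ρ₀ ρ₁ i) _ t := hd
    rw [hd'.fderiv]
    ext j
    by_cases hj : j = i
    · subst hj
      refine Fin.lastCases ?_ (fun k => ?_) k
      · simp [P, interpolateCoeff, (Fin.castSucc_lt_last _).ne]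
        ring
      · by_cases hk : k = j
        · subst hk
          simp [P, interpolateCoeff, (Fin.castSucc_lt_last _).ne']
        · simp [P, interpolateCoeff, hk, Ne.symm hk, (Fin.castSucc_lt_last _).ne']
    · refine Fin.lastCases ?_ (fun k => ?_) k
      · simp [P, interpolateCoeff, hj, (Fin.castSucc_lt_last _).ne]
      · by_cases hk : k = i
        · subst hk
          simp [P, hj]
        · simp [P, interpolateCoeff, hj, hk, Pi.single_apply]

/-- Reparametrizations of a coordinate with the same end points give homotopic spheres. -/
theorem homotopic_of_coord {A : LieAlgebroid E F V} {n : ℕ} {a : CubeMap F V n} (ha : a.IsSphere A)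
    {ρ₀ ρ₁ : ℝ → ℝ} (h₀ : IsIntervalMap ρ₀) (h₁ : IsIntervalMap ρ₁) (hz : ρ₀ 0 = ρ₁ 0)
    (ho : ρ₀ 1 = ρ₁ 1) (i : Fin n) {b₀ b₁ : Sphere A n}
    (e₀ : ∀ t ∈ cube n, b₀.1.EqAt (a.coord ρ₀ i) t)
    (e₁ : ∀ t ∈ cube n, b₁.1.EqAt (a.coord ρ₁ i) t) : Homotopic A n b₀ b₁ := by
  have hR := isReparam_interpolate h₀ h₁ i
  refine homotopic_iff.2 ⟨_, ha.isMorphism.reparam hR, fun t ht => ?_, fun t ht => ?_,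
    fun t ht j hj => ?_⟩
  · rw [(e₀ t ht).1]
    simp only [(e₀ t ht).2]
    simp [CubeMap.coord, CubeMap.reparam, interpolate, interpolateCoeff, extend]
  · rw [(e₁ t ht).1]
    simp only [(e₁ t ht).2]
    simp [CubeMap.coord, CubeMap.reparam, interpolate, interpolateCoeff, extend]
  -- The last component of the homotopy is `(ρ₁ - ρ₀)(t_i) a_i`. On the faces `t_i = 0, 1` the
  -- coefficient vanishes because the end points agree; on the other faces `a_i` vanishes because
  -- `a` is a sphere.
  · by_cases hji : j = i
    · subst hji
      have : interpolateCoeff ρ₀ ρ₁ j (Fin.last n) t = 0 := by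
        rcases hj with h | h <;> simp [interpolateCoeff, h, hz, ho]
      change (fibreSMul (interpolateCoeff ρ₀ ρ₁ j (Fin.last n) t) _).snd = 0
      rw [this]
      exact snd_fibreSMul_zero _
    · refine snd_fibreSMul_eq_zero _ (ha.boundary _ (hR.mapsTo ht) _ j ?_ ?_)
      · simpa using hji
      · simpa [interpolate, hji, Fin.init] using hj

theorem coord_id {n : ℕ} (a : CubeMap F V n) (i : Fin n) : a.coord id i = a := by
  simp [CubeMap.coord, CubeMap.reparam, fibreSMul_one]

theorem homotopic_equivalence (A : LieAlgebroid E F V) {n : ℕ} (hn : 2 ≤ n) :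
    Equivalence (Homotopic A n) where
  refl a := homotopic_of_coord a.2 isIntervalMap_id isIntervalMap_id rfl rfl ⟨0, by omega⟩
    (fun t _ => by rw [coord_id]; exact ⟨rfl, fun _ => rfl⟩)
    (fun t _ => by rw [coord_id]; exact ⟨rfl, fun _ => rfl⟩)
  symm h := by
    obtain ⟨h, H⟩ := homotopic_iff.1 h
    exact homotopic_iff.2 ⟨_, H.symm⟩
  trans h h' := by
    obtain ⟨h, H⟩ := homotopic_iff.1 h
    obtain ⟨h', H'⟩ := homotopic_iff.1 h'
    exact homotopic_iff.2 ⟨_, H.trans H' isStep_smoothTransition⟩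

end Homotopy

/-! ### Base points and concatenation of spheres -/

section Group

variable [FiniteDimensional ℝ E] [T2Space M]

theorem zero_mem_cube (n : ℕ) : (0 : Fin n → ℝ) ∈ cube n :=
  fun _ => ⟨le_rfl, zero_le_one⟩

/-- The base map of a sphere of dimension at least two is constant on the boundary. -/
theorem CubeMap.IsSphere.base_eq {A : LieAlgebroid E F V} {n : ℕ} (hn : 2 ≤ n) {a : CubeMap F V n}
    (ha : a.IsSphere A) {t : Fin n → ℝ} (ht : t ∈ cube n) {j : Fin n} (hj : t j = 0 ∨ t j = 1) :
    a.base t = a.base 0 := by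
  have step : ∀ {t : Fin n → ℝ}, t ∈ cube n → ∀ {j k : Fin n}, k ≠ j → (t j = 0 ∨ t j = 1) →
      a.base (Function.update t k 0) = a.base t := fun {t} ht {j k} hk hj =>
    ha.isMorphism.base_update ht k (fun r hr => ha.boundary _ (update_mem_cube ht k hr) k j hk.symm
      (by rwa [Function.update_of_ne hk.symm])) (Set.left_mem_Icc.2 zero_le_one)
  -- While `t_j` stays at `0` or `1`, the other coordinates can be set to `0` one at a time without
  -- moving the base point.
  have key : ∀ s : Finset (Fin n), j ∉ s →
      (fun l => if l ∈ s then 0 else t l) ∈ cube n ∧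
        a.base (fun l => if l ∈ s then 0 else t l) = a.base t := by
    intro s
    induction s using Finset.induction_on with
    | empty => intro _; simpa using ht
    | insert k s hk ih =>
      intro hjs
      rw [Finset.mem_insert, not_or] at hjs
      obtain ⟨h1, h2⟩ := ih hjs.2
      have e : (fun l => if l ∈ insert k s then 0 else t l) =
          Function.update (fun l => if l ∈ s then 0 else t l) k 0 := by
        funext l
        by_cases hl : l = k
        · subst hl
          simp
        · simp [hl]
      rw [e]
      exact ⟨update_mem_cube h1 k (Set.left_mem_Icc.2 zero_le_one),
        (step h1 (Ne.symm hjs.1) (by simpa [hjs.2] using hj)).trans h2⟩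
  obtain ⟨h1, h2⟩ := key (Finset.univ.erase j) (Finset.notMem_erase _ _)
  have : Nontrivial (Fin n) := Fin.nontrivial_iff_two_le.2 hn
  obtain ⟨k, hk⟩ := exists_ne j
  -- The point now also lies on the face `t_k = 0` for some `k ≠ j`, which exists since `n ≥ 2`;
  -- along that face `t_j` can be moved to `0`.
  rw [← h2, ← step h1 hk.symm (by simp [hk])]
  congr 1
  funext l
  by_cases hl : l = j
  · subst hl
    simp
  · simp [hl]

/-- The constant map `TI^n → V` with value `0` in the fibre over `x`. -/
def constMap (F : Type*) [NormedAddCommGroup F] [NormedSpace ℝ F] {V : M → Type*}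
    [∀ x, AddCommGroup (V x)] (n : ℕ) (x : M) : CubeMap F V n where
  base _ := x
  comp _ _ := ⟨x, 0⟩
  proj_comp _ _ := rfl

theorem CubeMap.ext_of {n : ℕ} {a b : CubeMap F V n} (h : a.base = b.base) (h' : a.comp = b.comp) :
    a = b := by
  cases a
  cases b
  obtain rfl := h
  obtain rfl := h'
  rfl

theorem coord_constMap {n : ℕ} (x : M) (ρ : ℝ → ℝ) (i : Fin n) :
    (constMap F (V := V) n x).coord ρ i = constMap F n x :=
  CubeMap.ext_of rfl (funext fun _ => funext fun _ =>
    congrArg (Bundle.TotalSpace.mk x) (smul_zero _))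

theorem coord_congr {n : ℕ} (a : CubeMap F V n) {ρ ρ' : ℝ → ℝ} {i : Fin n} {t : Fin n → ℝ}
    (h : ρ (t i) = ρ' (t i)) (hd : deriv ρ (t i) = deriv ρ' (t i)) :
    (a.coord ρ i).EqAt (a.coord ρ' i) t := by
  simp [CubeMap.coord, CubeMap.reparam, CubeMap.EqAt, h, hd]

theorem CubeMap.EqAt.trans {n : ℕ} {a b c : CubeMap F V n} {t : Fin n → ℝ} (h : a.EqAt b t)
    (h' : b.EqAt c t) : a.EqAt c t :=
  ⟨h.1.trans h'.1, fun k => (h.2 k).trans (h'.2 k)⟩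

theorem CubeMap.EqAt.symm {n : ℕ} {a b : CubeMap F V n} {t : Fin n → ℝ} (h : a.EqAt b t) :
    b.EqAt a t :=
  ⟨h.1.symm, fun k => (h.2 k).symm⟩

theorem fibreSMul_fibreSMul (c d : ℝ) (p : Bundle.TotalSpace F V) :
    fibreSMul c (fibreSMul d p) = fibreSMul (c * d) p :=
  congrArg (Bundle.TotalSpace.mk p.proj) (smul_smul c d p.snd)

/-- Concatenations along different coordinates satisfy the interchange law. -/
theorem concat_interchange {n : ℕ} (τ σ : ℝ → ℝ) {i j : Fin n} (hij : i ≠ j)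
    (a b c d : CubeMap F V n) :
    concat σ j (concat τ i a b) (concat τ i c d) =
      concat τ i (concat σ j a c) (concat σ j b d) := by
  refine CubeMap.ext_of ?_ ?_
  · funext t
    -- Since `i ≠ j`, neither reparametrization affects the other's test against `1/2`. Four boxes
    -- remain, on each of which the two updates commute.
    simp only [concat, Function.update_of_ne hij, Function.update_of_ne hij.symm]
    split_ifs <;> rw [Function.update_comm hij]
  · funext k t
    simp only [concat, Function.update_of_ne hij, Function.update_of_ne hij.symm]
    split_ifs <;> rw [Function.update_comm hij] <;> simp only [fibreSMul_fibreSMul, mul_comm]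

/-- On the common face both maps sit at the base point, and all components other than the `i`-th are
zero there. -/
theorem facesAgree_of_isSphere {A : LieAlgebroid E F V} {n : ℕ} (hn : 2 ≤ n)
    {a₁ a₀ : CubeMap F V n} (h₁ : a₁.IsSphere A) (h₀ : a₀.IsSphere A)
    (hb : a₁.base 0 = a₀.base 0) (i : Fin n) : FacesAgree i a₁ a₀ := by
  intro t ht
  have m0 := update_mem_cube ht i (Set.left_mem_Icc.2 zero_le_one)
  have m1 := update_mem_cube ht i (Set.right_mem_Icc.2 zero_le_one)
  have e : a₁.base (Function.update t i 0) = a₀.base (Function.update t i 1) := by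
    rw [h₁.base_eq hn m0 (j := i) (by simp), h₀.base_eq hn m1 (j := i) (by simp), hb]
  refine ⟨e, fun k hk => total_eq_of_snd_eq_zero ?_ ?_ ?_⟩
  · rw [a₁.proj_comp, a₀.proj_comp, e]
  · exact h₁.boundary _ m0 k i hk.symm (by simp)
  · exact h₀.boundary _ m1 k i hk.symm (by simp)

variable [FiniteDimensional ℝ F] [ContMDiffVectorBundle ∞ F V 𝓘(ℝ, E)]

theorem isSphere_constMap (A : LieAlgebroid E F V) (n : ℕ) (x : M) :
    (constMap F (V := V) n x).IsSphere A where
  isMorphism :=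
    { smooth_base := contMDiffOn_const
      smooth_comp := fun _ => contMDiffOn_const
      comm_zero := fun f t _ i => by
        simp [partialDeriv, constMap, A.dZero_zero_right]
      comm_one := fun ξ t _ i j X Y hX _ => by
        have hX0 : X x = 0 := Bundle.TotalSpace.mk_inj.1 hX
        have : A.dOne ξ X Y x = 0 := A.dOne_eq_zero_left ξ hX0
        change partialDeriv i (fun _ => ξ.toFun x 0) t - partialDeriv j (fun _ => ξ.toFun x 0) t =
          A.dOne ξ X Y x
        rw [this, map_zero]
        simp [partialDeriv] }
  boundary _ _ _ _ _ _ := rfl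

/-- The concatenation of spheres with the same base point is a sphere. -/
theorem CubeMap.IsSphere.concat {A : LieAlgebroid E F V} {n : ℕ} (hn : 2 ≤ n)
    {a₁ a₀ : CubeMap F V n} (h₁ : a₁.IsSphere A) (h₀ : a₀.IsSphere A)
    (hb : a₁.base 0 = a₀.base 0) {τ : ℝ → ℝ} (h : IsStep τ) (i : Fin n) :
    (concat τ i a₁ a₀).IsSphere A where
  isMorphism := h₁.isMorphism.concat h₀.isMorphism h (facesAgree_of_isSphere hn h₁ h₀ hb i)
  boundary _ ht k j hjk hj := concat_boundary h i (fun u hu hj => h₁.boundary u hu k j hjk hj)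
    (fun u hu hj => h₀.boundary u hu k j hjk hj) ht hj

theorem CubeMap.IsSphere.coord_reverse {A : LieAlgebroid E F V} {n : ℕ} {a : CubeMap F V n}
    (h : a.IsSphere A) (i : Fin n) : (a.coord (fun u => 1 - u) i).IsSphere A where
  isMorphism := h.isMorphism.coord isIntervalMap_reverse i
  boundary _ ht k j hjk hj :=
    coord_reverse_boundary i (fun u hu hj => h.boundary u hu k j hjk hj) ht hj

/-- Restricting a sphere to a face gives a constant map. -/
theorem CubeMap.IsSphere.coord_const {A : LieAlgebroid E F V} {n : ℕ} (hn : 2 ≤ n)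
    {a : CubeMap F V n} (h : a.IsSphere A) {r : ℝ} (hr : r = 0 ∨ r = 1) (i : Fin n)
    {t : Fin n → ℝ} (ht : t ∈ cube n) :
    (a.coord (fun _ => r) i).EqAt (constMap F n (a.base 0)) t := by
  have m : Function.update t i r ∈ cube n :=
    update_mem_cube ht i (by rcases hr with rfl | rfl <;> simp)
  have e : a.base (Function.update t i r) = a.base 0 := h.base_eq hn m (j := i) (by simpa using hr)
  refine ⟨e, fun k => total_eq_of_snd_eq_zero ?_ ?_ rfl⟩
  · exact (a.proj_comp _ _).trans e
  · by_cases hk : k = i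
    · subst hk
      have e : (a.coord (fun _ => r) k).comp k t = fibreSMul 0 (a.comp k (Function.update t k r)) := by
        simp [CubeMap.coord, CubeMap.reparam]
      rw [e]
      exact snd_fibreSMul_zero _
    · exact snd_fibreSMul_eq_zero _ (h.boundary _ m k i (Ne.symm hk) (by simpa using hr))

theorem CubeMap.RestrictsTo.concat {n : ℕ} {h h' : CubeMap F V (n + 1)} {a a' : CubeMap F V n}
    {ε : ℝ} (H : h.RestrictsTo ε a) (H' : h'.RestrictsTo ε a') {τ : ℝ → ℝ} (hτ : IsStep τ)
    (i : Fin n) :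
    (LieAlgebroidHomotopy.concat τ i.castSucc h' h).RestrictsTo ε
      (LieAlgebroidHomotopy.concat τ i a' a) := by
  intro t ht
  have m : ∀ r, Function.update t i (τ r) ∈ cube n := fun r => update_mem_cube ht i (hτ.mem_Icc r)
  constructor
  · simp only [LieAlgebroidHomotopy.concat, extend_castSucc, update_extend_castSucc,
      (H _ (m _)).1, (H' _ (m _)).1]
  · intro k
    simp only [LieAlgebroidHomotopy.concat, extend_castSucc, update_extend_castSucc,
      (H _ (m _)).2, (H' _ (m _)).2, Fin.castSucc_inj]

/-- Concatenation of homotopies. -/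
theorem IsHomotopy.concat {A : LieAlgebroid E F V} {n : ℕ} (hn : 2 ≤ n)
    {h h' : CubeMap F V (n + 1)} {a₀ a₁ b₀ b₁ : CubeMap F V n} (H : IsHomotopy A h a₀ b₀)
    (H' : IsHomotopy A h' a₁ b₁) (h₀ : a₀.IsSphere A) (h₁ : a₁.IsSphere A)
    (hb : a₁.base 0 = a₀.base 0) {τ : ℝ → ℝ} (hτ : IsStep τ) (i : Fin n) :
    IsHomotopy A (concat τ i.castSucc h' h) (concat τ i a₁ a₀) (concat τ i b₁ b₀) where
  isMorphism := by
    refine H'.isMorphism.concat H.isMorphism hτ fun t ht => ?_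
    obtain ⟨u, s, hu, hs, rfl⟩ : ∃ u s, u ∈ cube n ∧ s ∈ Set.Icc (0 : ℝ) 1 ∧ t = extend u s :=
      ⟨Fin.init t, t (Fin.last n), init_mem_cube ht, ht _, (Fin.snoc_init_self t).symm⟩
    have m0 := update_mem_cube hu i (Set.left_mem_Icc.2 zero_le_one)
    have m1 := update_mem_cube hu i (Set.right_mem_Icc.2 zero_le_one)
    rw [update_extend_castSucc, update_extend_castSucc]
    have e : h'.base (extend (Function.update u i 0) s) =
        h.base (extend (Function.update u i 1) s) := by
      rw [H'.base_eq m0 (j := i) (by simp) hs, H.base_eq m1 (j := i) (by simp) hs]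
      exact (facesAgree_of_isSphere hn h₁ h₀ hb i u hu).1
    refine ⟨e, fun k => ?_⟩
    refine Fin.lastCases (fun _ => ?_) (fun k hk => ?_) k
    · refine total_eq_of_snd_eq_zero ?_ ?_ ?_
      · rw [h'.proj_comp, h.proj_comp, e]
      · exact H'.boundary _ (extend_mem_cube m0 hs) i (by simp)
      · exact H.boundary _ (extend_mem_cube m1 hs) i (by simp)
    -- The components tangent to the slices vanish by propagation from the sphere at parameter `0`,
    -- not by the definition of a homotopy.
    · have hk' : i ≠ k := fun h => hk (by rw [h])
      refine total_eq_of_snd_eq_zero ?_ ?_ ?_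
      · rw [h'.proj_comp, h.proj_comp, e]
      · exact H'.comp_eq_zero h₁ m0 hk' (by simp) hs
      · exact H.comp_eq_zero h₀ m1 hk' (by simp) hs
  left := H.left.concat H'.left hτ i
  right := H.right.concat H'.right hτ i
  boundary _ ht j hj := concat_boundary hτ _ (fun u hu hj => H'.boundary u hu j hj)
    (fun u hu hj => H.boundary u hu j hj) ht hj

/-- The base point of a homotopy class of spheres. -/
def basePoint (A : LieAlgebroid E F V) {n : ℕ} (hn : 2 ≤ n) (c : HomotopyGroup A n) : M :=
  Quot.lift (fun a : Sphere A n => a.1.base 0) (fun a b hab => by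
    obtain ⟨h, H⟩ := homotopic_iff.1 hab
    have h1 := H.base_eq (zero_mem_cube n) (j := ⟨0, by omega⟩) (by simp)
      (Set.right_mem_Icc.2 zero_le_one)
    exact h1.symm.trans (H.right 0 (zero_mem_cube n)).1) c

theorem cls_eq_iff {A : LieAlgebroid E F V} {n : ℕ} (hn : 2 ≤ n) {a b : Sphere A n} :
    a.cls = b.cls ↔ Homotopic A n a b :=
  ⟨fun h => (homotopic_equivalence A hn).eqvGen_iff.1 (Quot.eqvGen_exact h), fun h => Quot.sound h⟩

/-! ### The operation on classes and the Eckmann–Hilton argument -/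

variable (A : LieAlgebroid E F V) {n : ℕ} (hn : 2 ≤ n)

/-- The concatenation of spheres. -/
def Sphere.concat {τ : ℝ → ℝ} (h : IsStep τ) (i : Fin n) (a₁ a₀ : Sphere A n)
    (hb : a₁.1.base 0 = a₀.1.base 0) : Sphere A n :=
  ⟨LieAlgebroidHomotopy.concat τ i a₁.1 a₀.1, a₁.2.concat hn a₀.2 hb h i⟩

theorem Sphere.concat_base_zero {τ : ℝ → ℝ} (h : IsStep τ) (i : Fin n) (a₁ a₀ : Sphere A n)
    (hb : a₁.1.base 0 = a₀.1.base 0) : (Sphere.concat A hn h i a₁ a₀ hb).1.base 0 = a₀.1.base 0 := by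
  simp [Sphere.concat, LieAlgebroidHomotopy.concat, h.eq_zero]

/-- The homotopy classes of spheres based at `x`. -/
def Fibre (n : ℕ) (hn : 2 ≤ n) (x : M) := {c : HomotopyGroup A n // basePoint A hn c = x}

variable {A hn} {x : M}

theorem Fibre.exists_rep (c : Fibre A n hn x) :
    ∃ (a : Sphere A n) (h : a.1.base 0 = x), c = ⟨a.cls, h⟩ := by
  obtain ⟨c, hc⟩ := c
  induction c using Quot.ind with
  | mk a => exact ⟨a, hc, rfl⟩

/-- Concatenation of homotopy classes. -/
def Fibre.op {τ : ℝ → ℝ} (h : IsStep τ) (i : Fin n) (c₁ c₀ : Fibre A n hn x) : Fibre A n hn x :=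
  ⟨(Sphere.concat A hn h i c₁.exists_rep.choose c₀.exists_rep.choose
    (c₁.exists_rep.choose_spec.1.trans c₀.exists_rep.choose_spec.1.symm)).cls,
    (Sphere.concat_base_zero ..).trans c₀.exists_rep.choose_spec.1⟩

/-- Independence of the chosen representatives: homotopies between representatives are concatenated
along the same coordinate. -/
theorem Fibre.op_mk {τ : ℝ → ℝ} (h : IsStep τ) (i : Fin n) (a₁ a₀ : Sphere A n)
    (h₁ : a₁.1.base 0 = x) (h₀ : a₀.1.base 0 = x) :
    Fibre.op h i (⟨a₁.cls, h₁⟩ : Fibre A n hn x) ⟨a₀.cls, h₀⟩ =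
      ⟨(Sphere.concat A hn h i a₁ a₀ (h₁.trans h₀.symm)).cls,
        (Sphere.concat_base_zero ..).trans h₀⟩ := by
  refine Subtype.ext ((cls_eq_iff hn).2 ?_)
  have s₁ := (Fibre.exists_rep (⟨a₁.cls, h₁⟩ : Fibre A n hn x)).choose_spec
  have s₀ := (Fibre.exists_rep (⟨a₀.cls, h₀⟩ : Fibre A n hn x)).choose_spec
  obtain ⟨k₁, H₁⟩ := homotopic_iff.1 ((cls_eq_iff hn).1 (Subtype.ext_iff.1 s₁.2).symm)
  obtain ⟨k₀, H₀⟩ := homotopic_iff.1 ((cls_eq_iff hn).1 (Subtype.ext_iff.1 s₀.2).symm)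
  exact homotopic_iff.2 ⟨_, H₀.concat hn H₁ (Subtype.property _) (Subtype.property _)
    (s₁.1.trans s₀.1.symm) h i⟩

/-- The class of the constant sphere. -/
def Fibre.one : Fibre A n hn x :=
  ⟨Sphere.cls ⟨constMap F n x, isSphere_constMap A n x⟩, rfl⟩

/-- Concatenating `a` with the constant sphere gives exactly `a` reparametrized by `τ (2u)` or `τ
(2u - 1)`. These maps fix `0` and `1`, hence interpolate to the identity. -/
theorem Fibre.isUnital_op {τ : ℝ → ℝ} (h : IsStep τ) (i : Fin n) :
    EckmannHilton.IsUnital (Fibre.op h i) (Fibre.one : Fibre A n hn x) where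
  left_id c := by
    obtain ⟨a, rfl, rfl⟩ := c.exists_rep
    refine (Fibre.op_mk h i ⟨constMap F n _, isSphere_constMap A n _⟩ a rfl rfl).trans ?_
    refine Subtype.ext ((cls_eq_iff hn).2 ?_)
    have hf := facesAgree_of_isSphere hn (isSphere_constMap A n (a.1.base 0)) a.2 rfl i
    refine homotopic_of_coord a.2 h.isIntervalMap_left isIntervalMap_id
      (by simp [h.eq_zero]) (by simp [h.eq_one]) i (fun t ht => ?_)
      (fun t _ => by rw [coord_id]; exact ⟨rfl, fun _ => rfl⟩)
    rcases le_total (t i) (1 / 2) with ht' | ht'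
    · exact concat_eqAt_left h i _ _ ht'
    · refine (concat_eqAt_right h i hf ht ht').trans ?_
      rw [coord_constMap]
      exact ((coord_left_eqAt h i _ ht').trans (a.2.coord_const hn (Or.inr rfl) i ht)).symm
  right_id c := by
    obtain ⟨a, rfl, rfl⟩ := c.exists_rep
    refine (Fibre.op_mk h i a ⟨constMap F n _, isSphere_constMap A n _⟩ rfl rfl).trans ?_
    refine Subtype.ext ((cls_eq_iff hn).2 ?_)
    have hf := facesAgree_of_isSphere hn a.2 (isSphere_constMap A n (a.1.base 0)) rfl i
    refine homotopic_of_coord a.2 h.isIntervalMap_right isIntervalMap_id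
      (by simp [h.eq_zero]) (by norm_num [h.eq_one]) i (fun t ht => ?_)
      (fun t _ => by rw [coord_id]; exact ⟨rfl, fun _ => rfl⟩)
    rcases le_total (t i) (1 / 2) with ht' | ht'
    · refine (concat_eqAt_left h i _ _ ht').trans ?_
      have e := coord_right_eqAt h i hf ht ht'
      rw [coord_constMap] at e ⊢
      exact e.symm
    · exact concat_eqAt_right h i hf ht ht'

theorem Fibre.op_interchange {τ σ : ℝ → ℝ} (hτ : IsStep τ) (hσ : IsStep σ) {i j : Fin n}
    (hij : i ≠ j) (a b c d : Fibre A n hn x) :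
    Fibre.op hσ j (Fibre.op hτ i a b) (Fibre.op hτ i c d) =
      Fibre.op hτ i (Fibre.op hσ j a c) (Fibre.op hσ j b d) := by
  obtain ⟨a, ha, rfl⟩ := a.exists_rep
  obtain ⟨b, hb, rfl⟩ := b.exists_rep
  obtain ⟨c, hc, rfl⟩ := c.exists_rep
  obtain ⟨d, hd, rfl⟩ := d.exists_rep
  simp only [Fibre.op_mk]
  exact Subtype.ext (congrArg Sphere.cls (Subtype.ext (concat_interchange τ σ hij _ _ _ _)))

/-- The concatenation of homotopy classes does not depend on the cut-off function and on the
coordinate. -/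
theorem Fibre.op_eq {τ σ : ℝ → ℝ} (hτ : IsStep τ) (hσ : IsStep σ) (i j : Fin n) :
    (Fibre.op hτ i : Fibre A n hn x → _ → _) = Fibre.op hσ j := by
  have key : ∀ {τ σ : ℝ → ℝ} (hτ : IsStep τ) (hσ : IsStep σ) {i j : Fin n}, i ≠ j →
      (Fibre.op hτ i : Fibre A n hn x → _ → _) = Fibre.op hσ j := fun {τ σ} hτ hσ {i j} hij =>
    (EckmannHilton.mul (Fibre.isUnital_op hσ j) (Fibre.isUnital_op hτ i)
      (Fibre.op_interchange hτ hσ hij)).symm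
  by_cases hij : i = j
  · subst hij
    -- Interchange requires distinct coordinates, so two cut-offs along the same coordinate are
    -- compared through a third operation along another one.
    have : Nontrivial (Fin n) := Fin.nontrivial_iff_two_le.2 hn
    obtain ⟨k, hk⟩ := exists_ne i
    exact (key hτ hτ hk.symm).trans (key hτ hσ hk)
  · exact key hτ hσ hij

/-- Since the operations along all coordinates coincide, interchange holds for one operation with
itself; with a unit this yields associativity and commutativity, and no associativity homotopy is
needed. -/
theorem Fibre.op_interchange_self {τ : ℝ → ℝ} (hτ : IsStep τ) (i : Fin n)
    (a b c d : Fibre A n hn x) :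
    Fibre.op hτ i (Fibre.op hτ i a b) (Fibre.op hτ i c d) =
      Fibre.op hτ i (Fibre.op hτ i a c) (Fibre.op hτ i b d) := by
  have : Nontrivial (Fin n) := Fin.nontrivial_iff_two_le.2 hn
  obtain ⟨k, hk⟩ := exists_ne i
  have := Fibre.op_interchange hτ hτ hk a b c d
  rwa [Fibre.op_eq hτ hτ k i] at this

/-- Following `a` by its reversal amounts to reparametrizing `a` by a path that runs from `0` to `1`
and back. Both ends are `0`, so it contracts to the constant path at `0`, where `a` is trivial. -/
theorem Fibre.exists_inverse {τ : ℝ → ℝ} (h : IsStep τ) (i : Fin n) (c : Fibre A n hn x) :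
    ∃ d, Fibre.op h i d c = Fibre.one := by
  obtain ⟨a, rfl, rfl⟩ := c.exists_rep
  let b : Sphere A n := ⟨_, a.2.coord_reverse i⟩
  have hb : b.1.base 0 = a.1.base 0 := by
    refine a.2.base_eq hn (update_mem_cube (zero_mem_cube n) i ?_) (j := i) ?_ <;> simp
  refine ⟨⟨b.cls, hb⟩, (Fibre.op_mk h i b a hb rfl).trans (Subtype.ext ((cls_eq_iff hn).2 ?_))⟩
  have hf := facesAgree_of_isSphere hn b.2 a.2 hb i
  have dl : ∀ u, DifferentiableAt ℝ (fun u => τ (2 * u)) u :=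
    h.isIntervalMap_left.smooth.differentiable (by simp)
  have dr : ∀ u, DifferentiableAt ℝ (fun u => τ (2 * u - 1)) u :=
    h.isIntervalMap_right.smooth.differentiable (by simp)
  have hd : ∀ u, deriv (fun u => τ (2 * u) - τ (2 * u - 1)) u =
      2 * deriv τ (2 * u) - 2 * deriv τ (2 * u - 1) := fun u => by
    rw [← h.deriv_left, ← h.deriv_right]
    exact deriv_fun_sub (dl u) (dr u)
  -- The formula equals `τ (2u)` on the first half and `1 - τ (2u - 1)` on the second, and it is
  -- smooth without any gluing.
  have hρ : IsIntervalMap fun u => τ (2 * u) - τ (2 * u - 1) := by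
    refine ⟨h.isIntervalMap_left.smooth.sub h.isIntervalMap_right.smooth, fun u _ => ?_⟩
    rcases le_total u (1 / 2) with hu | hu
    · have : τ (2 * u - 1) = 0 := h.eq_zero _ (by linarith)
      simpa [this] using h.mem_Icc (2 * u)
    · have : τ (2 * u) = 1 := h.eq_one _ (by linarith)
      simpa [this, and_comm] using h.mem_Icc (2 * u - 1)
  refine homotopic_of_coord a.2 hρ (isIntervalMap_const (Set.left_mem_Icc.2 zero_le_one))
    (by simp [h.eq_zero]) (by norm_num [h.eq_one]) i (fun t ht => ?_)
    (fun t ht => (a.2.coord_const hn (Or.inl rfl) i ht).symm)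
  rcases le_total (t i) (1 / 2) with ht' | ht'
  · have e1 : τ (2 * t i - 1) = 0 := h.eq_zero _ (by linarith)
    have e2 : deriv τ (2 * t i - 1) = 0 := h.deriv_eq_zero_of_nonpos (by linarith)
    exact (concat_eqAt_left h i _ _ ht').trans
      (coord_congr a.1 (by simp [e1]) (by rw [hd, h.deriv_left, e2]; ring))
  · have e1 : τ (2 * t i) = 1 := h.eq_one _ (by linarith)
    have e2 : deriv τ (2 * t i) = 0 := h.deriv_eq_zero_of_one_le (by linarith)
    refine (concat_eqAt_right h i hf ht ht').trans ⟨?_, fun k => ?_⟩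
    · simp [b, CubeMap.coord, CubeMap.reparam, e1]
    · simp only [b, CubeMap.coord, CubeMap.reparam, id, fibreSMul_fibreSMul, hd, h.deriv_right, e1,
        e2, Function.update_self, Function.update_idem]
      congr 1
      split_ifs <;> simp

variable (A hn x) in
/-- The abelian group of homotopy classes of spheres based at `x`. -/
abbrev Fibre.commGroup : CommGroup (Fibre A n hn x) :=
  let m : Fibre A n hn x → Fibre A n hn x → Fibre A n hn x :=
    Fibre.op isStep_smoothTransition ⟨0, by omega⟩
  have hu : EckmannHilton.IsUnital m Fibre.one := Fibre.isUnital_op _ _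
  have hd : ∀ a b c d, m (m a b) (m c d) = m (m a c) (m b d) := Fibre.op_interchange_self _ _
  { mul := m
    one := Fibre.one
    inv := fun c => (Fibre.exists_inverse isStep_smoothTransition ⟨0, by omega⟩ c).choose
    mul_assoc := (EckmannHilton.mul_assoc hu hu hd).assoc
    mul_comm := (EckmannHilton.mul_comm hu hu hd).comm
    one_mul := hu.left_id
    mul_one := hu.right_id
    inv_mul_cancel := fun c =>
      (Fibre.exists_inverse isStep_smoothTransition ⟨0, by omega⟩ c).choose_spec }

end Group

end

end LieAlgebroidHomotopy

end

theorem mainTheorem6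
    {E : Type*} [NormedAddCommGroup E] [NormedSpace ℝ E] [FiniteDimensional ℝ E]
    {M : Type*} [TopologicalSpace M] [ChartedSpace E M] [IsManifold 𝓘(ℝ, E) ∞ M]
    [T2Space M] [SecondCountableTopology M]
    {F : Type*} [NormedAddCommGroup F] [NormedSpace ℝ F] [FiniteDimensional ℝ F]
    {V : M → Type*} [TopologicalSpace (Bundle.TotalSpace F V)]
    [∀ x, AddCommGroup (V x)] [∀ x, Module ℝ (V x)] [∀ x, TopologicalSpace (V x)]
    [FiberBundle F V] [VectorBundle ℝ F V] [ContMDiffVectorBundle ∞ F V 𝓘(ℝ, E)]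
    (A : LieAlgebroidHomotopy.LieAlgebroid E F V) (n : ℕ) (hn : 2 ≤ n) :
    -- homotopy of spheres is an equivalence relation
    Equivalence (LieAlgebroidHomotopy.Homotopic A n) ∧
    -- the base point defines a surjection from the set of homotopy classes to the base
    ∃ p : LieAlgebroidHomotopy.HomotopyGroup A n → M, Function.Surjective p ∧
      (∀ a : LieAlgebroidHomotopy.Sphere A n, a.BasedAt (p a.cls)) ∧
      -- every fibre is an abelian group under concatenation of spheres
      ∀ x : M, ∃ _G : CommGroup {c : LieAlgebroidHomotopy.HomotopyGroup A n // p c = x},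
        ∀ τ : ℝ → ℝ, LieAlgebroidHomotopy.IsCutoff τ → ∀ i : Fin n,
        ∀ (a₁ a₀ : LieAlgebroidHomotopy.Sphere A n) (h₁ : p a₁.cls = x) (h₀ : p a₀.cls = x),
          ∃ b : LieAlgebroidHomotopy.Sphere A n,
            b.1 = LieAlgebroidHomotopy.concat τ i a₁.1 a₀.1 ∧
            ∃ hb : p b.cls = x,
              (⟨a₁.cls, h₁⟩ * ⟨a₀.cls, h₀⟩ :
                {c : LieAlgebroidHomotopy.HomotopyGroup A n // p c = x}) = ⟨b.cls, hb⟩ := by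
  open LieAlgebroidHomotopy in
  refine ⟨homotopic_equivalence A hn, basePoint A hn, fun x => ?_, fun a t ht ⟨j, hj⟩ => ?_,
    fun x => ⟨Fibre.commGroup A hn x, fun τ hτ i a₁ a₀ h₁ h₀ => ?_⟩⟩
  · exact ⟨Sphere.cls ⟨constMap F n x, isSphere_constMap A n x⟩, rfl⟩
  · exact a.2.base_eq hn ht hj
  · refine ⟨Sphere.concat A hn hτ.isStep i a₁ a₀ (h₁.trans h₀.symm), rfl,
      (Sphere.concat_base_zero ..).trans h₀, ?_⟩
    refine Eq.trans ?_ (Fibre.op_mk (hn := hn) hτ.isStep i a₁ a₀ h₁ h₀)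
    -- The group law was fixed with one particular step and coordinate; independence of both choices
    -- transfers it to the given `τ` and `i`.
    exact congrFun₂ (Fibre.op_eq isStep_smoothTransition hτ.isStep ⟨0, by omega⟩ i)
      ⟨a₁.cls, h₁⟩ ⟨a₀.cls, h₀⟩
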